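/- Let $\mathbb H=\{z\in\mathbb C:\operatorname{Im} z>0\}$ and $\overline{\mathbb H}=\{z\in\mathbb C:\operatorname{Im} z\ge 0\}$. Let $n\ge 2$, let $\gamma=\mu+\sigma i\in\mathbb H$, and let $X_1,\dots,X_n$ be i.i.d. real random variables having the Cauchy distribution with parameter $\gamma$, i.e. with density $x\mapsto \frac{\sigma}{\pi}\,\frac{1}{(x-\mu)^2+\sigma^2}$ on $\mathbb R$. For $p\in[-1,0)$ and $\alpha\in\overline{\mathbb H}$ let $f(z)=(z+\alpha)^p$ for $z\ne-\alpha$, $\operatorname{Im}(z+\alpha)\ge 0$, where $w^p=\exp(p\log w)$ with the principal branch of the logarithm ($\arg w\in(-\pi,\pi]$). The function $f$ is injective on this domain, which contains $\overline{\mathbb H}\setminus\{-\alpha\}$; let $f^{-1}$ be its inverse, and let $$M_n^f=f^{-1}\Big(\frac1n\sum_{j=1}^n f(X_j)\Big),$$ which is defined almost surely. Then: (i) If $p\in(-1,0)$ and $\alpha\in\overline{\mathbb H}$, then $M_n^f\in L^1$ and $E[M_n^f]=\gamma$. (ii) If $p=-1$ and $\alpha\in\mathbb R$, then $M_n^f\notin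 L^1$, i.e. $E[|M_n^f|]=+\infty$. (iii) If $p=-1$ and $\alpha\in\mathbb H$, then $M_n^f\in L^1$ and $E[M_n^f]=\gamma$. -/

import Mathlib

open MeasureTheory ProbabilityTheory

/-- The Cauchy distribution on `ℝ` with complex parameter `γ = μ + σ i` in the upper half-plane:
location `μ = Re γ`, scale `σ = Im γ`, density `x ↦ (σ / π) / ((x - μ) ^ 2 + σ ^ 2)`. -/
noncomputable def cauchyLaw (γ : ℂ) : Measure ℝ :=
  cauchyMeasure γ.re γ.im.toNNReal

/-- The quasi-arithmetic mean `f⁻¹ ((f x₁ + ⋯ + f xₙ) / n)`, where `f⁻¹ : f(U) → U` is the inverse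
of the generator `f`, which is injective on its domain `U`. -/
noncomputable def quasiArithmeticMean (f : ℂ → ℂ) (U : Set ℂ) {n : ℕ} (x : Fin n → ℝ) : ℂ :=
  Function.invFunOn f U ((∑ j, f (x j : ℂ)) / (n : ℂ))

/-- The generator `f(z) = (z + α) ^ p` (principal branch, `arg ∈ (-π, π]`). -/
noncomputable def powerGen (p : ℝ) (α : ℂ) (z : ℂ) : ℂ :=
  (z + α) ^ (p : ℂ)

/-- The domain of the generator `z ↦ (z + α) ^ p`: the points `z ≠ -α` with `Im (z + α) ≥ 0`.
It contains the closed upper half-plane minus `-α` whenever `Im α ≥ 0` (and equals it when `α` is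
real), and the generator is injective on it, so the inverse taken on it extends the inverse of
the generator restricted to the closed upper half-plane minus `-α`. -/
def powerDomain (α : ℂ) : Set ℂ :=
  {z | 0 ≤ (z + α).im ∧ z ≠ -α}

/-- The power mean `M_n^f` with generator `f(z) = (z + α) ^ p`. -/
noncomputable def powerMean (p : ℝ) (α : ℂ) {n : ℕ} (x : Fin n → ℝ) : ℂ :=
  quasiArithmeticMean (powerGen p α) (powerDomain α) x

theorem closedUpperHalfPlane_subset_powerDomain {α : ℂ} (hα : 0 ≤ α.im) :
    {z : ℂ | 0 ≤ z.im ∧ z ≠ -α} ⊆ powerDomain α := by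
  rintro z ⟨hz, hne⟩
  refine ⟨?_, hne⟩
  rw [Complex.add_im]
  exact add_nonneg hz hα

/-- On its domain, the generator is inverted by `w ↦ w ^ (1 / p) - α`. -/
theorem powerGen_leftInvOn {p : ℝ} (hp : -1 ≤ p) (hp0 : p < 0) (α : ℂ) :
    Set.LeftInvOn (fun w : ℂ => w ^ ((1 / p : ℝ) : ℂ) - α) (powerGen p α) (powerDomain α) := by
  rintro z ⟨hz, -⟩
  have key : ((z + α) ^ (p : ℂ)) ^ ((1 / p : ℝ) : ℂ) = z + α := by
    rcases hp.eq_or_lt with rfl | hp1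
    · norm_num [Complex.cpow_neg_one]
    · have h0 : 0 ≤ (z + α).arg := Complex.arg_nonneg_iff.2 hz
      have h1 : (z + α).arg ≤ Real.pi := Complex.arg_le_pi _
      have hpi := Real.pi_pos
      have him : (Complex.log (z + α) * (p : ℂ)).im = (z + α).arg * p := by
        simp [Complex.mul_im, Complex.log_im]
      rw [← Complex.cpow_mul]
      · have : (p : ℂ) * ((1 / p : ℝ) : ℂ) = 1 := by
          rw [← Complex.ofReal_mul, mul_one_div_cancel hp0.ne, Complex.ofReal_one]
        rw [this, Complex.cpow_one]
      · rw [him]; nlinarith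
      · rw [him]; nlinarith
  change ((z + α) ^ (p : ℂ)) ^ ((1 / p : ℝ) : ℂ) - α = z
  rw [key, add_sub_cancel_right]

theorem powerGen_injOn {p : ℝ} (hp : -1 ≤ p) (hp0 : p < 0) (α : ℂ) :
    Set.InjOn (powerGen p α) (powerDomain α) :=
  (powerGen_leftInvOn hp hp0 α).injOn

open Filter Topology Set

/-! If `h` is holomorphic and bounded on the closed upper half-plane, its Cauchy integral is `h γ`
(`integral_cauchyLaw_eq_of_bounded`). For Im α > 0 the closed form `powerMeanFormula` is holomorphic
in each variable and bounded in it, because n ≥ 2 leaves another variable whose power keeps the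
average away from 0. Replacing the coordinates by γ one at a time
(`integral_pi_eq_of_coordinatewise`) yields the value at (γ, …, γ), which is γ. Fubini requires
joint integrability, and this is where p matters.

For p > -1 the powers lie in a sector of opening less than π, so the average has norm at least a
constant times the p-th power of the geometric mean. Hence |M| is at most a constant times ∏ (1 +
|x_j|)^(1/n), plus a constant, and 1/n < 1 suffices. For p = -1 and Im α > 0, imaginary parts give
exponent 2/n instead, enough for n ≥ 3; n = 2 uses the explicit harmonic mean and
`mul_div_le_of_sqrt`.

For p > -1 the shift may reach the real line: approach α from above and use dominated convergence.
For p = -1 and real α, every one-variable section of the mean has a simple pole or grows linearly,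
so Fubini rules out integrability. -/

instance isProbabilityMeasure_cauchyLaw (γ : ℂ) : IsProbabilityMeasure (cauchyLaw γ) := by
  unfold cauchyLaw; infer_instance

/-! ### The Cauchy law as a density -/

/-- The density of the Cauchy law with parameter `γ`. -/
noncomputable def cauchyDensity (γ : ℂ) (x : ℝ) : ℝ :=
  γ.im / Real.pi * ((x - γ.re) ^ 2 + γ.im ^ 2)⁻¹

theorem cauchyDensity_nonneg {γ : ℂ} (hγ : 0 < γ.im) (x : ℝ) : 0 ≤ cauchyDensity γ x := by
  unfold cauchyDensity; positivity

theorem continuous_cauchyDensity {γ : ℂ} (hγ : 0 < γ.im) : Continuous (cauchyDensity γ) := by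
  unfold cauchyDensity
  refine continuous_const.mul (Continuous.inv₀ (by fun_prop) fun x => ?_)
  positivity

theorem cauchyPDFReal_eq_cauchyDensity {γ : ℂ} (hγ : 0 < γ.im) (x : ℝ) :
    cauchyPDFReal γ.re γ.im.toNNReal x = cauchyDensity γ x := by
  rw [cauchyPDFReal_def, cauchyDensity, Real.coe_toNNReal _ hγ.le]
  ring

theorem cauchyLaw_eq_withDensity {γ : ℂ} (hγ : 0 < γ.im) :
    cauchyLaw γ = volume.withDensity fun x => ENNReal.ofReal (cauchyDensity γ x) := by
  rw [cauchyLaw, cauchyMeasure_of_scale_ne_zero _ (by simpa using hγ)]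
  congr 1
  ext x
  rw [cauchyPDF_def, cauchyPDFReal_eq_cauchyDensity hγ]

theorem integrable_cauchyDensity {γ : ℂ} (hγ : 0 < γ.im) : Integrable (cauchyDensity γ) := by
  have := integrable_cauchyPDFReal γ.re (γ := γ.im.toNNReal)
  exact this.congr (ae_of_all _ fun x => cauchyPDFReal_eq_cauchyDensity hγ x)

theorem integral_cauchyDensity {γ : ℂ} (hγ : 0 < γ.im) : ∫ x, cauchyDensity γ x = 1 := by
  rw [← integral_cauchyPDFReal_eq_one γ.re (γ := γ.im.toNNReal) (by simpa using hγ)]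
  simp_rw [cauchyPDFReal_eq_cauchyDensity hγ]

theorem integrable_cauchyLaw_iff {E : Type*} [NormedAddCommGroup E] [NormedSpace ℝ E]
    {γ : ℂ} (hγ : 0 < γ.im) {g : ℝ → E} :
    Integrable g (cauchyLaw γ) ↔ Integrable (fun x => cauchyDensity γ x • g x) := by
  rw [cauchyLaw_eq_withDensity hγ, integrable_withDensity_iff_integrable_smul'
    (continuous_cauchyDensity hγ).measurable.ennreal_ofReal (by simp)]
  simp_rw [ENNReal.toReal_ofReal (cauchyDensity_nonneg hγ _)]

theorem integral_cauchyLaw {E : Type*} [NormedAddCommGroup E] [NormedSpace ℝ E]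
    {γ : ℂ} (hγ : 0 < γ.im) (g : ℝ → E) :
    ∫ x, g x ∂(cauchyLaw γ) = ∫ x, cauchyDensity γ x • g x := by
  rw [cauchyLaw_eq_withDensity hγ, integral_withDensity_eq_integral_toReal_smul
    (continuous_cauchyDensity hγ).measurable.ennreal_ofReal (by simp)]
  simp_rw [ENNReal.toReal_ofReal (cauchyDensity_nonneg hγ _)]

theorem cauchyLaw_absolutelyContinuous {γ : ℂ} (hγ : 0 < γ.im) : cauchyLaw γ ≪ volume := by
  rw [cauchyLaw_eq_withDensity hγ]
  exact withDensity_absolutelyContinuous _ _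

theorem cauchyLaw_singleton {γ : ℂ} (hγ : 0 < γ.im) (x : ℝ) : cauchyLaw γ {x} = 0 :=
  cauchyLaw_absolutelyContinuous hγ (by simp)

theorem normSq_ofReal_sub (γ : ℂ) (x : ℝ) :
    Complex.normSq ((x : ℂ) - γ) = (x - γ.re) ^ 2 + γ.im ^ 2 := by
  simp [Complex.normSq_apply]; ring

/-! ### Poisson formula on the upper half-plane -/

/-- A function holomorphic on the closed upper half-plane that decays quadratically has zero
integral over the real line. -/
theorem integral_ofReal_eq_zero_of_quadratic_decay {r : ℂ → ℂ} {a b K : ℝ} (hb : 0 ≤ b)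
    (hrd : DifferentiableOn ℂ r {z | 0 ≤ z.im}) (hintr : Integrable fun x : ℝ => r x)
    (hrb : ∀ R : ℝ, 0 < R → ∀ z : ℂ, 0 ≤ z.im → (R ≤ |z.re - a| ∨ R + b ≤ z.im) →
      ‖r z‖ ≤ K / R ^ 2) :
    ∫ x : ℝ, r x = 0 := by
  have hlim : Tendsto (fun R : ℝ => ∫ x in (a - R)..(a + R), r x) atTop
      (𝓝 (∫ x : ℝ, r x)) := intervalIntegral_tendsto_integral hintr
    (tendsto_atBot_add_const_left atTop a tendsto_neg_atTop_atBot)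
    (tendsto_atTop_add_const_left atTop a tendsto_id)
  -- `4 * R + 2 * b` is the total length of the top side (2R) and the two vertical sides (b + R
  -- each) of the contour rectangle.
  refine tendsto_nhds_unique hlim (squeeze_zero_norm' (a := fun R : ℝ => K / R ^ 2 * (4 * R + 2 * b)) ?_ ?_)
  · filter_upwards [eventually_gt_atTop 0] with R hR
    have key := Complex.integral_boundary_rect_eq_zero_of_differentiableOn r
      ((a - R : ℝ) : ℂ) (⟨a + R, b + R⟩) (hrd.mono (by
        rintro z ⟨-, hz⟩
        simp only [Complex.ofReal_im, mem_preimage] at hz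
        rw [uIcc_of_le (by linarith)] at hz
        exact hz.1))
    simp only [Complex.ofReal_re, Complex.ofReal_im, Complex.ofReal_zero, zero_mul,
      add_zero] at key
    have e : (∫ x in (a - R)..(a + R), r x) =
        (∫ x : ℝ in (a - R)..(a + R), r (x + (b + R : ℝ) * Complex.I))
        - Complex.I • (∫ y : ℝ in (0 : ℝ)..(b + R), r ((a + R : ℝ) + y * Complex.I))
        + Complex.I • (∫ y : ℝ in (0 : ℝ)..(b + R), r ((a - R : ℝ) + y * Complex.I)) := by
      linear_combination key
    rw [e]
    have b1 : ‖∫ x : ℝ in (a - R)..(a + R), r (x + (b + R : ℝ) * Complex.I)‖ ≤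
        K / R ^ 2 * |a + R - (a - R)| := by
      refine intervalIntegral.norm_integral_le_of_norm_le_const fun x _ => hrb R hR _ ?_ (Or.inr ?_)
      · simp; linarith
      · simp; linarith
    have b2 : ∀ s : ℝ, |s| = R → ‖∫ y : ℝ in (0 : ℝ)..(b + R), r ((a + s : ℝ) + y * Complex.I)‖ ≤
        K / R ^ 2 * |b + R - 0| := by
      intro s hs
      refine intervalIntegral.norm_integral_le_of_norm_le_const fun y hy => hrb R hR _ ?_ (Or.inl ?_)
      · rw [uIoc_of_le (by linarith)] at hy
        simp; exact hy.1.le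
      · simp [hs]
    have b3 := b2 R (abs_of_pos hR)
    have b4 := b2 (-R) (by rw [abs_neg, abs_of_pos hR])
    rw [← sub_eq_add_neg] at b4
    rw [abs_of_pos (by linarith)] at b1 b3 b4
    refine (norm_add_le _ _).trans ?_
    refine (add_le_add_left (norm_sub_le _ _) _).trans ?_
    simp only [norm_smul, Complex.norm_I, one_mul]
    linarith
  · have h1 : Tendsto (fun R : ℝ => 4 * K * R⁻¹ + 2 * K * b * (R⁻¹) ^ 2) atTop (𝓝 (4 * K * 0 + 2 * K * b * 0 ^ 2)) :=
      (tendsto_inv_atTop_zero.const_mul _).add ((tendsto_inv_atTop_zero.pow 2).const_mul _)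
    simp only [mul_zero, ne_eq, OfNat.ofNat_ne_zero, not_false_eq_true, zero_pow, add_zero] at h1
    refine h1.congr' ?_
    filter_upwards [eventually_gt_atTop 0] with R hR
    field_simp

/-- The Poisson integral formula for bounded holomorphic functions on the upper half-plane. -/
theorem integral_cauchyLaw_eq_of_bounded {γ : ℂ} (hγ : 0 < γ.im) {h : ℂ → ℂ} {B : ℝ}
    (hd : DifferentiableOn ℂ h {z | 0 ≤ z.im}) (hB : ∀ z : ℂ, 0 ≤ z.im → ‖h z‖ ≤ B) :
    ∫ x : ℝ, h x ∂(cauchyLaw γ) = h γ := by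
  set S : Set ℂ := {z | 0 ≤ z.im} with hS
  have hγS : γ ∈ S := hγ.le
  have hB0 : 0 ≤ B := (norm_nonneg _).trans (hB γ hγ.le)
  have hnhds : S ∈ 𝓝 γ :=
    mem_of_superset ((isOpen_lt continuous_const Complex.continuous_im).mem_nhds hγ)
      fun z (hz : 0 < z.im) => hz.le
  have hconj : ∀ z ∈ S, z - (starRingEnd ℂ) γ ≠ 0 := fun z (hz : 0 ≤ z.im) h0 => by
    have := congrArg Complex.im h0
    simp at this; linarith
  -- `dslope` removes the singularity at γ, so Cauchy's theorem suffices and no residue is computed.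
  -- On the real line `r` is the density times `h x - h γ`, up to the factor σ/π.
  set r : ℂ → ℂ := fun z => dslope h γ z / (z - (starRingEnd ℂ) γ) with hr
  have hrd : DifferentiableOn ℂ r S :=
    ((Complex.differentiableOn_dslope hnhds).2 hd).div (by fun_prop) hconj
  have hrform : ∀ z, z ≠ γ → r z = (h z - h γ) / ((z - γ) * (z - (starRingEnd ℂ) γ)) := by
    intro z hz
    simp only [hr, dslope_of_ne _ hz, slope_def_field, div_div]
  have hrb : ∀ R : ℝ, 0 < R → ∀ z ∈ S, R ≤ ‖z - γ‖ → R ≤ ‖z - (starRingEnd ℂ) γ‖ →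
      ‖r z‖ ≤ 2 * B / R ^ 2 := by
    intro R hR z hz h1 h2
    have hne : z ≠ γ := by rintro rfl; simp at h1; linarith
    rw [hrform z hne, norm_div, norm_mul, pow_two]
    have h3 : ‖h z - h γ‖ ≤ 2 * B := (norm_sub_le _ _).trans (by
      linarith [hB z hz, hB γ hγS])
    gcongr
  have hxne : ∀ x : ℝ, (x : ℂ) ≠ γ := fun x hx => by
    have := congrArg Complex.im hx
    simp at this; linarith
  have hrx : ∀ x : ℝ, r x = ((x - γ.re) ^ 2 + γ.im ^ 2 : ℝ)⁻¹ * (h x - h γ) := by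
    intro x
    rw [hrform _ (hxne x), ← normSq_ofReal_sub, Complex.ofReal_inv, Complex.normSq_eq_conj_mul_self,
      map_sub, Complex.conj_ofReal, mul_comm ((x : ℂ) - γ), div_eq_inv_mul]
  have hdens : ∀ x : ℝ, cauchyDensity γ x • (h x - h γ) = ((γ.im / Real.pi : ℝ) : ℂ) * r x := by
    intro x
    rw [hrx, cauchyDensity, Complex.real_smul]; push_cast; ring
  have hcont : Continuous fun x : ℝ => h x :=
    hd.continuousOn.comp_continuous Complex.continuous_ofReal fun x => by simp [hS]
  have hintd : Integrable fun x : ℝ => cauchyDensity γ x • (h x - h γ) := by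
    refine ((integrable_cauchyDensity hγ).mul_const (2 * B)).mono'
      ((continuous_cauchyDensity hγ).smul (hcont.sub continuous_const)).aestronglyMeasurable
      (ae_of_all _ fun x => ?_)
    rw [norm_smul, Real.norm_of_nonneg (cauchyDensity_nonneg hγ x)]
    refine mul_le_mul_of_nonneg_left ((norm_sub_le _ _).trans ?_) (cauchyDensity_nonneg hγ x)
    linarith [hB x (by simp), hB γ hγS]
  have hintr : Integrable fun x : ℝ => r x := by
    have hc : ((γ.im / Real.pi : ℝ) : ℂ) ≠ 0 := by
      rw [Complex.ofReal_ne_zero]; positivity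
    refine (hintd.const_mul ((γ.im / Real.pi : ℝ) : ℂ)⁻¹).congr (ae_of_all _ fun x => ?_)
    simp only [hdens]; field_simp
  have hzero : ∫ x : ℝ, r x = 0 := by
    refine integral_ofReal_eq_zero_of_quadratic_decay (a := γ.re) (K := 2 * B) hγ.le hrd hintr
      fun R hR z hz h => hrb R hR z hz ?_ ?_
    · rcases h with h | h
      · exact h.trans (by simpa using Complex.abs_re_le_norm (z - γ))
      · refine le_trans (le_trans ?_ (le_abs_self _)) (Complex.abs_im_le_norm _)
        simp; linarith
    · rcases h with h | h
      · exact h.trans (by simpa using Complex.abs_re_le_norm (z - (starRingEnd ℂ) γ))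
      · refine le_trans (le_trans ?_ (le_abs_self _)) (Complex.abs_im_le_norm _)
        simp; linarith
  rw [integral_cauchyLaw hγ]
  have h1 : ∫ x : ℝ, cauchyDensity γ x • (h x - h γ) = 0 := by
    simp_rw [hdens]
    rw [integral_const_mul, hzero, mul_zero]
  have h2 : ∫ x : ℝ, cauchyDensity γ x • h γ = h γ := by
    rw [integral_smul_const, integral_cauchyDensity hγ, one_smul]
  rw [← add_zero (h γ), ← h1, ← h2, ← integral_add ((integrable_cauchyDensity hγ).smul_const _)]
  · rw [h2]
    refine integral_congr_ae (ae_of_all _ fun x => ?_)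
    simp only [smul_sub]; ring
  · rw [h2]; exact hintd

/-! ### Evaluation one coordinate at a time -/

/-- The value `s` is a placeholder overwritten by the update; it brings the vector into the form in
which the coordinatewise hypothesis is stated. -/
theorem ofReal_insertNth_zero {n : ℕ} (t : ℝ) (x : Fin n → ℝ) (s : ℂ) :
    (fun i => ((Fin.insertNth (α := fun _ => ℝ) 0 t x i : ℝ) : ℂ)) =
      Function.update (Fin.cons (α := fun _ => ℂ) s fun i => (x i : ℂ)) 0 (t : ℂ) := by
  ext i
  refine Fin.cases ?_ (fun i => ?_) i <;> simp

/-- If integrating each coordinate of `F` against `μ` amounts to evaluating it at `γ`, then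
integrating against the product measure amounts to evaluating `F` at the constant vector `γ`. -/
theorem integral_pi_eq_of_coordinatewise {μ : Measure ℝ} [IsProbabilityMeasure μ] {γ : ℂ}
    {S : Set ℂ} (hS : ∀ x : ℝ, (x : ℂ) ∈ S) (hγ : γ ∈ S) :
    ∀ (n : ℕ) (F : (Fin n → ℂ) → ℂ),
      (∀ j z, (∀ i, z i ∈ S) →
        ∫ t : ℝ, F (Function.update z j t) ∂μ = F (Function.update z j γ)) →
      Integrable (fun x : Fin n → ℝ => F fun i => x i) (Measure.pi fun _ => μ) →
      ∫ x : Fin n → ℝ, F (fun i => x i) ∂(Measure.pi fun _ => μ) = F fun _ => γ := by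
  intro n
  induction n with
  | zero =>
    intro F _ _
    rw [Measure.pi_of_empty (fun _ : Fin 0 => μ) (fun i => i.elim0), integral_dirac]
    congr 1
    ext i
    exact i.elim0
  | succ n ih =>
    intro F hF hint
    have hmp := (measurePreserving_piFinSuccAbove (fun _ : Fin (n + 1) => μ) 0).symm
    have hint' : Integrable (fun y : ℝ × (Fin n → ℝ) =>
        F (fun i => ((Fin.insertNth (α := fun _ => ℝ) 0 y.1 y.2 i : ℝ) : ℂ)))
        (μ.prod (Measure.pi fun _ => μ)) :=
      (hmp.integrable_comp_emb (MeasurableEquiv.measurableEmbedding _)).2 hint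
    have hinner : ∀ x : Fin n → ℝ,
        ∫ t : ℝ, F (fun i => ((Fin.insertNth (α := fun _ => ℝ) 0 t x i : ℝ) : ℂ)) ∂μ =
          F (Fin.cons (α := fun _ => ℂ) γ fun i => (x i : ℂ)) := by
      intro x
      simp_rw [fun t => ofReal_insertNth_zero t x γ]
      rw [hF 0 _ (fun i => by refine Fin.cases ?_ (fun i => ?_) i <;> simp [hγ, hS])]
      simp
    -- Induction is applied to `F` with its first coordinate frozen at γ. By `hinner` this is the
    -- inner integral, so Fubini supplies its integrability.
    have h1 := ih (fun z => F (Fin.cons (α := fun _ => ℂ) γ z)) (fun j z hz => by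
      have := hF j.succ (Fin.cons (α := fun _ => ℂ) γ z)
        (fun i => by refine Fin.cases ?_ (fun i => ?_) i <;> simp [hγ, hz])
      simpa only [Fin.cons_update] using this)
      (by simpa only [hinner] using hint'.integral_prod_right)
    rw [← hmp.integral_comp (MeasurableEquiv.measurableEmbedding _)]
    refine (integral_prod_symm _ hint').trans ?_
    simp only [hinner]
    rw [h1]
    congr 1
    ext i
    refine Fin.cases ?_ (fun i => ?_) i <;> simp

/-! ### Closed form of the power mean -/

/-- The argument bounds say exactly that `w.arg / p` lies in [0, π]: the root then lands in the
closed upper half-plane and the principal branch lets the exponents multiply. -/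
theorem powerGen_rightInv {p : ℝ} (hp0 : p < 0) (α : ℂ) {w : ℂ} (hw : w ≠ 0)
    (h1 : p * Real.pi ≤ w.arg) (h2 : w.arg ≤ 0) :
    w ^ ((1 / p : ℝ) : ℂ) - α ∈ powerDomain α ∧ powerGen p α (w ^ ((1 / p : ℝ) : ℂ) - α) = w := by
  have hpi := Real.pi_pos
  have him : (Complex.log w * ((1 / p : ℝ) : ℂ)).im = w.arg / p := by
    rw [Complex.mul_im, Complex.log_im, Complex.ofReal_im, Complex.ofReal_re]; ring
  have hl : 0 ≤ w.arg / p := div_nonneg_of_nonpos h2 hp0.le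
  have hu : w.arg / p ≤ Real.pi := by
    rw [div_le_iff_of_neg hp0]; linarith
  refine ⟨⟨?_, fun h => ?_⟩, ?_⟩
  · rw [sub_add_cancel, Complex.cpow_def_of_ne_zero hw, Complex.exp_im, him]
    exact mul_nonneg (Real.exp_pos _).le (Real.sin_nonneg_of_nonneg_of_le_pi hl hu)
  · have : w ^ ((1 / p : ℝ) : ℂ) = 0 := by linear_combination h
    exact hw (Complex.cpow_eq_zero_iff _ _ |>.1 this).1
  · rw [powerGen, sub_add_cancel, ← Complex.cpow_mul _ (by rw [him]; linarith) (by rw [him]; exact hu),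
      ← Complex.ofReal_mul, one_div_mul_cancel hp0.ne, Complex.ofReal_one, Complex.cpow_one]

/-- The value `w ^ (1 / p) - α` at the average `w` of the numbers `(z j + α) ^ p`. -/
noncomputable def powerMeanFormula (p : ℝ) (α : ℂ) {n : ℕ} (z : Fin n → ℂ) : ℂ :=
  ((∑ j, (z j + α) ^ (p : ℂ)) / (n : ℂ)) ^ ((1 / p : ℝ) : ℂ) - α

theorem powerMean_eq_formula {p : ℝ} (hp : -1 ≤ p) (hp0 : p < 0) (α : ℂ) {n : ℕ} (x : Fin n → ℝ)
    (hw : (∑ j, ((x j : ℂ) + α) ^ (p : ℂ)) / (n : ℂ) ≠ 0)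
    (h1 : p * Real.pi ≤ ((∑ j, ((x j : ℂ) + α) ^ (p : ℂ)) / (n : ℂ)).arg)
    (h2 : ((∑ j, ((x j : ℂ) + α) ^ (p : ℂ)) / (n : ℂ)).arg ≤ 0) :
    powerMean p α x = powerMeanFormula p α fun j => x j := by
  obtain ⟨hm, hv⟩ := powerGen_rightInv hp0 α hw h1 h2
  have hi := (powerGen_injOn hp hp0 α).leftInvOn_invFunOn hm
  rw [hv] at hi
  exact hi

theorem measurable_powerMeanFormula (p : ℝ) (α : ℂ) (n : ℕ) :
    Measurable fun x : Fin n → ℝ => powerMeanFormula p α fun j => (x j : ℂ) := by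
  unfold powerMeanFormula
  fun_prop

theorem powerMeanFormula_const {p : ℝ} (hp : -1 ≤ p) (hp0 : p < 0) {α γ : ℂ} (hα : 0 ≤ α.im)
    (hγ : 0 < γ.im) {n : ℕ} (hn : n ≠ 0) : powerMeanFormula p α (fun _ : Fin n => γ) = γ := by
  have h := powerGen_leftInvOn hp hp0 α (x := γ)
    (closedUpperHalfPlane_subset_powerDomain hα ⟨hγ.le, fun h => by
      rw [h, Complex.neg_im] at hγ; linarith⟩)
  have hn' : (n : ℂ) ≠ 0 := Nat.cast_ne_zero.2 hn
  rw [powerMeanFormula, Finset.sum_const, Finset.card_univ, Fintype.card_fin, nsmul_eq_mul,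
    mul_div_cancel_left₀ _ hn']
  exact h

/-! ### The sector containing the powers, and averages in it -/

section Cone

variable {p : ℝ} {u : ℂ}

theorem cpow_eq_polar (hu : u ≠ 0) (p : ℝ) :
    u ^ (p : ℂ) = ((‖u‖ ^ p : ℝ) : ℂ) * Complex.exp ((p * u.arg : ℝ) * Complex.I) := by
  rw [Complex.cpow_def_of_ne_zero hu, Real.rpow_def_of_pos (norm_pos_iff.2 hu), Complex.ofReal_exp,
    ← Complex.exp_add]
  congr 1
  conv_lhs => rw [← Complex.re_add_im (Complex.log u), Complex.log_re, Complex.log_im]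
  push_cast; ring

theorem cpow_mul_exp_eq_polar (hu : u ≠ 0) (p s : ℝ) :
    u ^ (p : ℂ) * Complex.exp ((s : ℝ) * Complex.I) =
      ((‖u‖ ^ p : ℝ) : ℂ) * Complex.exp ((p * u.arg + s : ℝ) * Complex.I) := by
  rw [cpow_eq_polar hu, mul_assoc, ← Complex.exp_add]
  congr 2; push_cast; ring

theorem cpow_im_nonpos (hp : -1 ≤ p) (hp0 : p < 0) (hu : 0 ≤ u.im) : (u ^ (p : ℂ)).im ≤ 0 := by
  rcases eq_or_ne u 0 with rfl | h0
  · rw [Complex.zero_cpow (by exact_mod_cast hp0.ne)]; simp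
  have h1 := Complex.arg_nonneg_iff.2 hu
  have h2 := Complex.arg_le_pi u
  rw [cpow_eq_polar h0, Complex.im_ofReal_mul, Complex.exp_ofReal_mul_I_im]
  refine mul_nonpos_of_nonneg_of_nonpos (by positivity)
    (Real.sin_nonpos_of_nonpos_of_neg_pi_le ?_ ?_) <;> nlinarith

theorem cpow_im_neg (hp : -1 ≤ p) (hp0 : p < 0) (hu : 0 < u.im) : (u ^ (p : ℂ)).im < 0 := by
  have h0 : u ≠ 0 := by rintro rfl; simp at hu
  have h1 : 0 < u.arg := lt_of_le_of_ne (Complex.arg_nonneg_iff.2 hu.le) fun h => by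
    have := (Complex.arg_eq_zero_iff.1 h.symm).2; linarith
  have h2 : u.arg < Real.pi := lt_of_le_of_ne (Complex.arg_le_pi u) fun h => by
    have := (Complex.arg_eq_pi_iff.1 h).2; linarith
  rw [cpow_eq_polar h0, Complex.im_ofReal_mul, Complex.exp_ofReal_mul_I_im]
  have := norm_pos_iff.2 h0
  refine mul_neg_of_pos_of_neg (by positivity)
    (Real.sin_neg_of_neg_of_neg_pi_lt ?_ ?_) <;> nlinarith

/-- Together with `cpow_im_nonpos` this places the powers in an intersection of two half-planes,
both stable under sums. -/
theorem cpow_rotate_im_nonneg (hp : -1 ≤ p) (hp0 : p < 0) (hu : 0 ≤ u.im) :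
    0 ≤ (u ^ (p : ℂ) * Complex.exp ((-p * Real.pi : ℝ) * Complex.I)).im := by
  rcases eq_or_ne u 0 with rfl | h0
  · rw [Complex.zero_cpow (by exact_mod_cast hp0.ne)]; simp
  have h1 := Complex.arg_nonneg_iff.2 hu
  have h2 := Complex.arg_le_pi u
  rw [cpow_mul_exp_eq_polar h0, Complex.im_ofReal_mul, Complex.exp_ofReal_mul_I_im]
  refine mul_nonneg (by positivity)
    (Real.sin_nonneg_of_nonneg_of_le_pi ?_ ?_) <;> nlinarith

/-- The rotation makes the sector symmetric about the positive real axis, with half-opening |p|π/2.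
-/
theorem cpow_rotate_re_ge (hp : -1 ≤ p) (hp0 : p < 0) (hu : 0 ≤ u.im) (h0 : u ≠ 0) :
    Real.cos (p * (Real.pi / 2)) * ‖u‖ ^ p ≤
      (u ^ (p : ℂ) * Complex.exp ((-p * (Real.pi / 2) : ℝ) * Complex.I)).re := by
  have h1 := Complex.arg_nonneg_iff.2 hu
  have h2 := Complex.arg_le_pi u
  have hpi := Real.pi_pos
  rw [cpow_mul_exp_eq_polar h0, Complex.re_ofReal_mul, Complex.exp_ofReal_mul_I_re, mul_comm]
  refine mul_le_mul_of_nonneg_left ?_ (by positivity)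
  rw [← Real.cos_abs (p * (Real.pi / 2)), ← Real.cos_abs (p * u.arg + _)]
  refine Real.cos_le_cos_of_nonneg_of_le_pi (abs_nonneg _) ?_ ?_
  · rw [abs_le]; constructor <;> nlinarith
  · rw [abs_of_neg (a := p * (Real.pi / 2)) (by nlinarith), abs_le]; constructor <;> nlinarith

theorem arg_mem_of_cone {p : ℝ} (hp : -1 < p) (hp0 : p < 0) {w : ℂ} (hw : w ≠ 0) (h1 : w.im ≤ 0)
    (h2 : 0 ≤ (w * Complex.exp ((-p * Real.pi : ℝ) * Complex.I)).im) :
    p * Real.pi ≤ w.arg ∧ w.arg ≤ 0 := by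
  have hpi := Real.pi_pos
  have hn := norm_pos_iff.2 hw
  have hform : (w * Complex.exp ((-p * Real.pi : ℝ) * Complex.I)).im =
      ‖w‖ * Real.sin (w.arg - p * Real.pi) := by
    conv_lhs => rw [← Complex.norm_mul_exp_arg_mul_I w]
    rw [mul_assoc, ← Complex.exp_add, ← add_mul, ← Complex.ofReal_add, Complex.im_ofReal_mul,
      Complex.exp_ofReal_mul_I_im]
    ring_nf
  rw [hform] at h2
  have h3 : 0 ≤ Real.sin (w.arg - p * Real.pi) := nonneg_of_mul_nonneg_right h2 hn
  have hle : w.arg ≤ 0 := by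
    -- The condition Im w ≤ 0 leaves only arg w = π to exclude; there the second half-plane
    -- condition would force sin(pπ) ≥ 0, false for -1 < p < 0.
    by_contra! h
    have h4 : w.arg = Real.pi := by
      refine le_antisymm (Complex.arg_le_pi w) ?_
      by_contra! h5
      have := Real.sin_pos_of_pos_of_lt_pi h h5
      rw [Complex.sin_arg] at this
      have := div_nonpos_of_nonpos_of_nonneg h1 hn.le
      linarith
    rw [h4, Real.sin_pi_sub] at h3
    have := Real.sin_neg_of_neg_of_neg_pi_lt (x := p * Real.pi) (by nlinarith) (by nlinarith)
    linarith
  refine ⟨?_, hle⟩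
  by_contra! h
  have := Real.sin_neg_of_neg_of_neg_pi_lt (x := w.arg - p * Real.pi) (by linarith)
    (by have := Complex.neg_pi_lt_arg w; nlinarith)
  linarith

end Cone

section Average

variable {p : ℝ} {n : ℕ} {u : Fin n → ℂ}

/-- No term has positive imaginary part, so nothing cancels: a single variable bounds the average
away from 0, uniformly in the others. -/
theorem average_im_le (hp : -1 ≤ p) (hp0 : p < 0) (hu : ∀ j, 0 ≤ (u j).im) (j : Fin n) :
    ((∑ j, u j ^ (p : ℂ)) / (n : ℂ)).im ≤ (u j ^ (p : ℂ)).im / n := by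
  rw [Complex.div_natCast_im, Complex.im_sum]
  refine div_le_div_of_nonneg_right ?_ (Nat.cast_nonneg n)
  rw [← Finset.add_sum_erase _ _ (Finset.mem_univ j)]
  have : ∑ i ∈ Finset.univ.erase j, (u i ^ (p : ℂ)).im ≤ 0 :=
    Finset.sum_nonpos fun i _ => cpow_im_nonpos hp hp0 (hu i)
  linarith

/-- After rotation by the bisector, the norm dominates the real part, which is additive. -/
theorem le_norm_average (hp : -1 ≤ p) (hp0 : p < 0) (hu : ∀ j, 0 ≤ (u j).im) (h0 : ∀ j, u j ≠ 0) :
    Real.cos (p * (Real.pi / 2)) * ((∑ j, ‖u j‖ ^ p) / n) ≤ ‖(∑ j, u j ^ (p : ℂ)) / (n : ℂ)‖ := by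
  rw [norm_div, Complex.norm_natCast, ← mul_div_assoc]
  refine div_le_div_of_nonneg_right ?_ (Nat.cast_nonneg n)
  have h1 : ‖∑ j, u j ^ (p : ℂ)‖ =
      ‖(∑ j, u j ^ (p : ℂ)) * Complex.exp ((-p * (Real.pi / 2) : ℝ) * Complex.I)‖ := by
    rw [norm_mul, Complex.norm_exp_ofReal_mul_I, mul_one]
  rw [h1]
  refine le_trans ?_ (Complex.re_le_norm _)
  rw [Finset.sum_mul, Complex.re_sum, Finset.mul_sum]
  exact Finset.sum_le_sum fun j _ => cpow_rotate_re_ge hp hp0 (hu j) (h0 j)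

theorem average_arg_mem (hp : -1 < p) (hp0 : p < 0) (hu : ∀ j, 0 ≤ (u j).im)
    (hw : (∑ j, u j ^ (p : ℂ)) / (n : ℂ) ≠ 0) :
    p * Real.pi ≤ ((∑ j, u j ^ (p : ℂ)) / (n : ℂ)).arg ∧
      ((∑ j, u j ^ (p : ℂ)) / (n : ℂ)).arg ≤ 0 := by
  refine arg_mem_of_cone hp hp0 hw ?_ ?_
  · rw [Complex.div_natCast_im, Complex.im_sum]
    exact div_nonpos_of_nonpos_of_nonneg
      (Finset.sum_nonpos fun i _ => cpow_im_nonpos hp.le hp0 (hu i)) (Nat.cast_nonneg n)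
  · rw [div_mul_eq_mul_div, Finset.sum_mul, Complex.div_natCast_im, Complex.im_sum]
    exact div_nonneg
      (Finset.sum_nonneg fun i _ => cpow_rotate_im_nonneg hp.le hp0 (hu i)) (Nat.cast_nonneg n)

theorem cos_mul_pi_div_two_pos (hp : -1 < p) (hp0 : p < 0) :
    0 < Real.cos (p * (Real.pi / 2)) := by
  have := Real.pi_pos
  exact Real.cos_pos_of_mem_Ioo ⟨by nlinarith, by nlinarith⟩

/-- The power mean of positive reals with exponent `p` dominates the geometric mean to the power
`p`. -/
theorem prod_rpow_le_average (hn : n ≠ 0) (p : ℝ) {a : Fin n → ℝ} (ha : ∀ j, 0 < a j) :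
    (∏ j, a j ^ (1 / n : ℝ)) ^ p ≤ (∑ j, a j ^ p) / n := by
  have hn' : (0 : ℝ) < n := Nat.cast_pos.2 (Nat.pos_of_ne_zero hn)
  have h := Real.geom_mean_le_arith_mean_weighted Finset.univ (fun _ : Fin n => (1 / n : ℝ))
    (fun j => a j ^ p) (fun _ _ => by positivity) (by simp [hn'.ne'])
    (fun j _ => Real.rpow_nonneg (ha j).le _)
  rw [← Finset.mul_sum, one_div_mul_eq_div] at h
  refine le_trans (le_of_eq ?_) h
  rw [← Real.finsetProd_rpow _ _ fun j _ => by have := ha j; positivity]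
  refine Finset.prod_congr rfl fun j _ => ?_
  rw [← Real.rpow_mul (ha j).le, ← Real.rpow_mul (ha j).le, mul_comm]

end Average

/-! ### Shift in the open half-plane: the mean value -/

theorem norm_powerMeanFormula_le {p : ℝ} (hp0 : p < 0) (α : ℂ) {n : ℕ} {z : Fin n → ℂ} {δ : ℝ}
    (hδ : 0 < δ) (h : δ ≤ ‖(∑ j, (z j + α) ^ (p : ℂ)) / (n : ℂ)‖) :
    ‖powerMeanFormula p α z‖ ≤ δ ^ (1 / p) + ‖α‖ := by
  refine (norm_sub_le _ _).trans (add_le_add_left ?_ _)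
  rw [Complex.norm_cpow_real]
  exact Real.rpow_le_rpow_of_nonpos hδ h (one_div_nonpos.2 hp0.le)

theorem average_im_neg {p : ℝ} (hp : -1 ≤ p) (hp0 : p < 0) {n : ℕ} (hn : n ≠ 0) {u : Fin n → ℂ}
    (hu : ∀ j, 0 < (u j).im) : ((∑ j, u j ^ (p : ℂ)) / (n : ℂ)).im < 0 := by
  have hn' : (0 : ℝ) < n := Nat.cast_pos.2 (Nat.pos_of_ne_zero hn)
  refine (average_im_le hp hp0 (fun j => (hu j).le) ⟨0, Nat.pos_of_ne_zero hn⟩).trans_lt ?_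
  exact div_neg_of_neg_of_pos (cpow_im_neg hp hp0 (hu _)) hn'

/-- The average lies strictly below the real axis, so its argument is in (-π, 0); this covers p = -1
and needs no exceptional null set. -/
theorem powerMean_eq_formula_of_im_pos {p : ℝ} (hp : -1 ≤ p) (hp0 : p < 0) {α : ℂ}
    (hα : 0 < α.im) {n : ℕ} (hn : n ≠ 0) (x : Fin n → ℝ) :
    powerMean p α x = powerMeanFormula p α fun j => x j := by
  have him := average_im_neg hp hp0 hn (u := fun j => (x j : ℂ) + α) (fun j => by simpa using hα)
  have hw : (∑ j, ((x j : ℂ) + α) ^ (p : ℂ)) / (n : ℂ) ≠ 0 := fun h => by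
    rw [h] at him; simp at him
  refine powerMean_eq_formula hp hp0 α x hw ?_ (Complex.arg_neg_iff.2 him).le
  rcases hp.eq_or_lt with rfl | hp1
  · have := Complex.neg_pi_lt_arg ((∑ j, ((x j : ℂ) + α) ^ (((-1 : ℝ)) : ℂ)) / (n : ℂ))
    linarith
  · exact (average_arg_mem hp1 hp0 (fun j => by simpa using hα.le) hw).1

/-- The Poisson formula applies because a second index `k ≠ j` gives a bound independent of the
moving variable. -/
theorem integral_powerMeanFormula_update {p : ℝ} (hp : -1 ≤ p) (hp0 : p < 0) {α γ : ℂ}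
    (hα : 0 < α.im) (hγ : 0 < γ.im) {n : ℕ} (hn : 2 ≤ n) (j : Fin n) (z : Fin n → ℂ)
    (hz : ∀ i, 0 ≤ (z i).im) :
    ∫ t : ℝ, powerMeanFormula p α (Function.update z j t) ∂(cauchyLaw γ) =
      powerMeanFormula p α (Function.update z j γ) := by
  have hn0 : n ≠ 0 := by omega
  have hpos : ∀ t : ℂ, 0 ≤ t.im → ∀ i, 0 < (Function.update z j t i + α).im := by
    intro t ht i
    rw [Complex.add_im]
    rcases eq_or_ne i j with rfl | hij
    · rw [Function.update_self]; linarith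
    · rw [Function.update_of_ne hij]; linarith [hz i]
  obtain ⟨k, hk⟩ : ∃ k : Fin n, k ≠ j := by
    have : Nontrivial (Fin n) := Fin.nontrivial_iff_two_le.2 hn
    exact exists_ne j
  have hδ : 0 < -((z k + α) ^ (p : ℂ)).im / n := by
    have := cpow_im_neg hp hp0 (u := z k + α) (by rw [Complex.add_im]; linarith [hz k])
    have hn' : (0 : ℝ) < n := Nat.cast_pos.2 (Nat.pos_of_ne_zero hn0)
    exact div_pos (by linarith) hn'
  refine integral_cauchyLaw_eq_of_bounded hγ
    (h := fun t => powerMeanFormula p α (Function.update z j t))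
    (B := (-((z k + α) ^ (p : ℂ)).im / n) ^ (1 / p) + ‖α‖) ?_ ?_
  · intro t ht
    refine DifferentiableAt.differentiableWithinAt ?_
    unfold powerMeanFormula
    refine (DifferentiableAt.cpow_const (DifferentiableAt.div_const
      (DifferentiableAt.fun_sum fun i _ => DifferentiableAt.cpow_const ?_ ?_) _) ?_).sub_const _
    · rcases eq_or_ne i j with rfl | hij
      · simp only [Function.update_self]; fun_prop
      · simp only [Function.update_of_ne hij]; fun_prop
    · exact Or.inr (hpos t ht i).ne'
    · exact Or.inr (average_im_neg hp hp0 hn0 (hpos t ht)).ne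
  · intro t ht
    refine norm_powerMeanFormula_le hp0 α hδ ?_
    refine le_trans ?_ (Complex.abs_im_le_norm _)
    refine le_trans ?_ (neg_le_abs _)
    have := average_im_le hp hp0 (fun i => (hpos t ht i).le) k
    rw [Function.update_of_ne hk] at this
    rw [neg_div]
    linarith

theorem integral_powerMeanFormula {p : ℝ} (hp : -1 ≤ p) (hp0 : p < 0) {α γ : ℂ}
    (hα : 0 < α.im) (hγ : 0 < γ.im) {n : ℕ} (hn : 2 ≤ n)
    (hint : Integrable (fun x : Fin n → ℝ => powerMeanFormula p α fun i => (x i : ℂ))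
      (Measure.pi fun _ => cauchyLaw γ)) :
    ∫ x : Fin n → ℝ, powerMeanFormula p α (fun i => (x i : ℂ)) ∂(Measure.pi fun _ => cauchyLaw γ)
      = γ := by
  rw [integral_pi_eq_of_coordinatewise (S := {z | 0 ≤ z.im}) (γ := γ) (by simp) hγ.le n
    (powerMeanFormula p α)
    (fun j z hz => integral_powerMeanFormula_update hp hp0 hα hγ hn j z hz) hint]
  exact powerMeanFormula_const hp hp0 hα.le hγ (by omega)

/-! ### Density bounds and integrability of the mean -/

theorem exists_cauchyDensity_le {γ : ℂ} (hγ : 0 < γ.im) :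
    ∃ C, 0 ≤ C ∧ ∀ x, cauchyDensity γ x ≤ C * ((1 + |x|) ^ 2)⁻¹ := by
  -- From (1 + |x|)² ≤ 2(1 + |μ|)² + 2(x - μ)²: the first term is absorbed by σ², the second by (x -
  -- μ)².
  set D := 2 * (1 + |γ.re|) ^ 2 / γ.im ^ 2 + 2 with hD
  refine ⟨γ.im / Real.pi * D, by positivity, fun x => ?_⟩
  rw [cauchyDensity, mul_assoc]
  refine mul_le_mul_of_nonneg_left ?_ (by positivity)
  have h1 : (1 + |x|) ^ 2 ≤ D * ((x - γ.re) ^ 2 + γ.im ^ 2) := by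
    have h2 : 1 + |x| ≤ (1 + |γ.re|) + |x - γ.re| := by
      have := abs_add_le γ.re (x - γ.re)
      rw [add_sub_cancel] at this; linarith
    have h3 : (1 + |x|) ^ 2 ≤ ((1 + |γ.re|) + |x - γ.re|) ^ 2 := by gcongr
    have h4 : D * ((x - γ.re) ^ 2 + γ.im ^ 2) = 2 * (1 + |γ.re|) ^ 2 / γ.im ^ 2 * (x - γ.re) ^ 2
        + 2 * (1 + |γ.re|) ^ 2 + 2 * (x - γ.re) ^ 2 + 2 * γ.im ^ 2 := by
      rw [hD]; field_simp; ring
    rw [h4]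
    have h5 : 0 ≤ 2 * (1 + |γ.re|) ^ 2 / γ.im ^ 2 * (x - γ.re) ^ 2 := by positivity
    nlinarith [sq_abs (x - γ.re), sq_nonneg ((1 + |γ.re|) - |x - γ.re|), sq_nonneg γ.im]
  rw [inv_eq_one_div, inv_eq_one_div, mul_one_div, div_le_div_iff₀ (by positivity) (by positivity)]
  linarith

theorem exists_le_cauchyDensity {γ : ℂ} (hγ : 0 < γ.im) :
    ∃ c, 0 < c ∧ ∀ x, c * ((1 + |x|) ^ 2)⁻¹ ≤ cauchyDensity γ x := by
  set D := 2 + 2 * γ.re ^ 2 + γ.im ^ 2 with hD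
  refine ⟨γ.im / Real.pi / D, by positivity, fun x => ?_⟩
  rw [cauchyDensity, div_mul_eq_mul_div, mul_div_assoc]
  refine mul_le_mul_of_nonneg_left ?_ (by positivity)
  have h1 : (x - γ.re) ^ 2 + γ.im ^ 2 ≤ D * (1 + |x|) ^ 2 := by
    have h0 := abs_nonneg x
    have h2 := sq_abs x
    have h3 : 1 ≤ (1 + |x|) ^ 2 := by nlinarith
    have h4 : x ^ 2 ≤ (1 + |x|) ^ 2 := by nlinarith
    have h5 : (2 * γ.re ^ 2 + γ.im ^ 2) * 1 ≤ (2 * γ.re ^ 2 + γ.im ^ 2) * (1 + |x|) ^ 2 := by gcongr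
    nlinarith [sq_nonneg (x + γ.re)]
  rw [inv_eq_one_div, inv_eq_one_div, div_div, div_le_div_iff₀ (by positivity) (by positivity)]
  linarith

/-- Against the quadratic decay of the density the integrand is O((1 + |x|)^(s - 2)), with exponent
below -1. -/
theorem integrable_rpow_one_add_abs {γ : ℂ} (hγ : 0 < γ.im) {s : ℝ} (hs : s < 1) :
    Integrable (fun x : ℝ => (1 + |x|) ^ s) (cauchyLaw γ) := by
  obtain ⟨C, hC0, hC⟩ := exists_cauchyDensity_le hγ
  rw [integrable_cauchyLaw_iff hγ]
  have h := (integrable_one_add_norm (E := ℝ) (μ := volume) (r := 2 - s)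
    (by simp; linarith)).const_mul C
  have hpos : ∀ x : ℝ, 0 < 1 + |x| := fun x => by positivity
  refine h.mono' ?_ (ae_of_all _ fun x => ?_)
  · refine ((continuous_cauchyDensity hγ).smul (Continuous.rpow_const (by fun_prop)
      fun x => Or.inl (hpos x).ne')).aestronglyMeasurable
  · rw [smul_eq_mul, Real.norm_of_nonneg (mul_nonneg (cauchyDensity_nonneg hγ x) (by positivity))]
    refine (mul_le_mul_of_nonneg_right (hC x) (by positivity)).trans (le_of_eq ?_)
    rw [Real.norm_eq_abs, neg_sub, Real.rpow_sub (hpos x), mul_assoc, Real.rpow_two, div_eq_inv_mul]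

theorem integrable_prod_rpow {γ : ℂ} (hγ : 0 < γ.im) {s : ℝ} (hs : s < 1) (n : ℕ) {K : ℝ}
    (hK : 0 ≤ K) :
    Integrable (fun x : Fin n → ℝ => ∏ j, (K * (1 + |x j|)) ^ s)
      (Measure.pi fun _ => cauchyLaw γ) := by
  refine Integrable.fintype_prod (f := fun _ t => (K * (1 + |t|)) ^ s) fun _ => ?_
  have : ∀ t : ℝ, (K * (1 + |t|)) ^ s = K ^ s * (1 + |t|) ^ s := fun t =>
    Real.mul_rpow hK (by positivity)
  simp_rw [this]
  exact (integrable_rpow_one_add_abs hγ hs).const_mul _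

theorem norm_ofReal_add_le {α : ℂ} {A : ℝ} (hA : ‖α‖ ≤ A) (x : ℝ) :
    ‖(x : ℂ) + α‖ ≤ (A + 1) * (1 + |x|) := by
  have h0 := abs_nonneg x
  have h1 := norm_add_le (x : ℂ) α
  have h2 := norm_nonneg α
  rw [Complex.norm_real, Real.norm_eq_abs] at h1
  nlinarith

/-- A lower bound of the average by a power of the geometric mean bounds the power mean. -/
theorem norm_powerMeanFormula_le_prod {p q c A : ℝ} (hp0 : p < 0) (hq : q ≤ 0) (hc : 0 < c)
    {α : ℂ} (hA : ‖α‖ ≤ A) {n : ℕ} (x : Fin n → ℝ) (h0 : ∀ j, (x j : ℂ) + α ≠ 0)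
    (h : c * (∏ j, ‖(x j : ℂ) + α‖ ^ (1 / n : ℝ)) ^ q ≤
      ‖(∑ j, ((x j : ℂ) + α) ^ (p : ℂ)) / (n : ℂ)‖) :
    ‖powerMeanFormula p α fun j => (x j : ℂ)‖ ≤
      c ^ (1 / p) * ∏ j, ((A + 1) * (1 + |x j|)) ^ (q / p / n) + A := by
  have hn0 : ∀ j, 0 < ‖(x j : ℂ) + α‖ := fun j => norm_pos_iff.2 (h0 j)
  have hP : 0 < ∏ j, ‖(x j : ℂ) + α‖ ^ (1 / n : ℝ) :=
    Finset.prod_pos fun j _ => Real.rpow_pos_of_pos (hn0 j) _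
  refine (norm_powerMeanFormula_le hp0 α (by positivity) h).trans (add_le_add ?_ hA)
  rw [Real.mul_rpow hc.le (by positivity), ← Real.rpow_mul hP.le,
    ← Real.finsetProd_rpow _ _ fun j _ => by positivity]
  refine mul_le_mul_of_nonneg_left (Finset.prod_le_prod (fun j _ => by positivity) fun j _ => ?_)
    (by positivity)
  rw [← Real.rpow_mul (hn0 j).le]
  have e : (1 / n : ℝ) * (q * (1 / p)) = q / p / n := by ring
  rw [e]
  exact Real.rpow_le_rpow (hn0 j).le (norm_ofReal_add_le hA _)
    (div_nonneg (div_nonneg_of_nonpos hq hp0.le) (Nat.cast_nonneg n))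

/-- The case `q = p`. The bound depends on α only through `A`, so it can dominate a sequence of
shifts. -/
theorem norm_powerMeanFormula_le_of_neg_one_lt {p A : ℝ} (hp : -1 < p) (hp0 : p < 0) {α : ℂ}
    (hα : 0 ≤ α.im) (hA : ‖α‖ ≤ A) {n : ℕ} (hn : n ≠ 0) (x : Fin n → ℝ)
    (h0 : ∀ j, (x j : ℂ) + α ≠ 0) :
    ‖powerMeanFormula p α fun j => (x j : ℂ)‖ ≤ Real.cos (p * (Real.pi / 2)) ^ (1 / p) *
      ∏ j, ((A + 1) * (1 + |x j|)) ^ (1 / n : ℝ) + A := by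
  have hc := cos_mul_pi_div_two_pos hp hp0
  have := norm_powerMeanFormula_le_prod hp0 hp0.le hc hA x h0
    ((mul_le_mul_of_nonneg_left (prod_rpow_le_average hn p fun j => norm_pos_iff.2 (h0 j))
      hc.le).trans (le_norm_average hp.le hp0 (fun j => by simpa using hα) h0))
  rwa [div_self hp0.ne] at this

/-- At p = -1 the cosine constant vanishes. The substitute is -Im(1/u) = Im α / |u|² for u = x_j +
α, whence `q = -2`. -/
theorem norm_powerMeanFormula_neg_one_le {α : ℂ} (hα : 0 < α.im) {n : ℕ} (hn : n ≠ 0)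
    (x : Fin n → ℝ) :
    ‖powerMeanFormula (-1) α fun j => (x j : ℂ)‖ ≤ α.im ^ (1 / (-1) : ℝ) *
      ∏ j, ((‖α‖ + 1) * (1 + |x j|)) ^ ((-2) / (-1) / n : ℝ) + ‖α‖ := by
  have h0 : ∀ j, (x j : ℂ) + α ≠ 0 := fun j h => by
    have := congrArg Complex.im h
    simp at this; linarith
  refine norm_powerMeanFormula_le_prod (by norm_num) (by norm_num) hα le_rfl x h0 ?_
  refine (mul_le_mul_of_nonneg_left (prod_rpow_le_average hn (-2) fun j => norm_pos_iff.2 (h0 j))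
      hα.le).trans ?_
  refine le_trans (le_of_eq ?_) ((neg_le_abs _).trans (Complex.abs_im_le_norm _))
  rw [Complex.div_natCast_im, Complex.im_sum, ← mul_div_assoc, ← neg_div, Finset.mul_sum,
    ← Finset.sum_neg_distrib]
  congr 1
  refine Finset.sum_congr rfl fun j _ => ?_
  rw [Complex.ofReal_neg, Complex.ofReal_one, Complex.cpow_neg_one, Complex.inv_im,
    Complex.normSq_eq_norm_sq, Real.rpow_neg (norm_nonneg _), Real.rpow_two]
  simp [div_eq_mul_inv]

theorem integrable_powerMeanFormula_of_neg_one_lt {p : ℝ} (hp : -1 < p) (hp0 : p < 0) {α γ : ℂ}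
    (hα : 0 < α.im) (hγ : 0 < γ.im) {n : ℕ} (hn : 2 ≤ n) :
    Integrable (fun x : Fin n → ℝ => powerMeanFormula p α fun i => (x i : ℂ))
      (Measure.pi fun _ => cauchyLaw γ) := by
  have hn' : (2 : ℝ) ≤ n := by exact_mod_cast hn
  refine ((((integrable_prod_rpow hγ (s := 1 / n) ?_ n (K := ‖α‖ + 1) (by positivity)).const_mul
    (Real.cos (p * (Real.pi / 2)) ^ (1 / p))).add (integrable_const ‖α‖))).mono'
    (measurable_powerMeanFormula p α n).aestronglyMeasurable (ae_of_all _ fun x => ?_)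
  · rw [div_lt_one (by linarith)]; linarith
  · refine norm_powerMeanFormula_le_of_neg_one_lt hp hp0 hα.le le_rfl (by omega) x fun j h => ?_
    have := congrArg Complex.im h
    simp at this; linarith

theorem integrable_powerMeanFormula_neg_one_of_three_le {α γ : ℂ}
    (hα : 0 < α.im) (hγ : 0 < γ.im) {n : ℕ} (hn : 3 ≤ n) :
    Integrable (fun x : Fin n → ℝ => powerMeanFormula (-1) α fun i => (x i : ℂ))
      (Measure.pi fun _ => cauchyLaw γ) := by
  have hn' : (3 : ℝ) ≤ n := by exact_mod_cast hn
  refine ((((integrable_prod_rpow hγ (s := (-2) / (-1) / n) ?_ n (K := ‖α‖ + 1)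
    (by positivity)).const_mul (α.im ^ (1 / (-1) : ℝ))).add (integrable_const ‖α‖))).mono'
    (measurable_powerMeanFormula (-1) α n).aestronglyMeasurable (ae_of_all _ fun x => ?_)
  · rw [div_lt_one (by linarith)]; linarith
  · exact norm_powerMeanFormula_neg_one_le hα (by omega) x

/-! ### Harmonic mean of two variables -/

theorem one_add_abs_le_norm_ofReal_add {α : ℂ} (hα : 0 < α.im) (x : ℝ) :
    1 + |x| ≤ (1 + (1 + ‖α‖) / α.im) * ‖(x : ℂ) + α‖ := by
  have h1 : α.im ≤ ‖(x : ℂ) + α‖ := by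
    simpa using (le_abs_self _).trans (Complex.abs_im_le_norm ((x : ℂ) + α))
  have h2 : |x| ≤ ‖(x : ℂ) + α‖ + ‖α‖ := by
    have := norm_sub_le ((x : ℂ) + α) α
    rwa [add_sub_cancel_right, Complex.norm_real, Real.norm_eq_abs] at this
  have h3 : 1 + ‖α‖ ≤ (1 + ‖α‖) / α.im * ‖(x : ℂ) + α‖ := by
    rw [div_mul_eq_mul_div, le_div_iff₀ hα]
    exact mul_le_mul_of_nonneg_left h1 (by positivity)
  linarith

theorem integrable_inv_sqrt_norm_pow_three {β : ℂ} (hβ : 0 < β.im) :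
    Integrable fun y : ℝ => (Real.sqrt ‖(y : ℂ) + β‖ ^ 3)⁻¹ := by
  set k := 1 + (1 + ‖β‖) / β.im with hk
  have hk0 : 0 < k := by positivity
  have h := (integrable_one_add_norm (E := ℝ) (μ := volume) (r := 3 / 2) (by simp; norm_num)).const_mul
    (k ^ (3 / 2 : ℝ))
  have hpos : ∀ y : ℝ, 0 < ‖(y : ℂ) + β‖ := fun y => norm_pos_iff.2 fun h0 => by
    have := congrArg Complex.im h0
    simp at this; linarith
  refine h.mono' ?_ (ae_of_all _ fun y => ?_)
  · refine (Continuous.inv₀ (by fun_prop) fun y => ?_).aestronglyMeasurable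
    have := hpos y; positivity
  · have e : Real.sqrt ‖(y : ℂ) + β‖ ^ 3 = ‖(y : ℂ) + β‖ ^ (3 / 2 : ℝ) := by
      rw [Real.sqrt_eq_rpow, ← Real.rpow_natCast, ← Real.rpow_mul (hpos y).le]; norm_num
    rw [e, Real.norm_of_nonneg (by positivity), Real.rpow_neg (by positivity), ← div_eq_mul_inv,
      inv_eq_one_div, div_le_div_iff₀ (Real.rpow_pos_of_pos (hpos y) _) (by positivity), one_mul,
      ← Real.mul_rpow hk0.le (hpos y).le]
    exact Real.rpow_le_rpow (by positivity) (one_add_abs_le_norm_ofReal_add hβ y) (by norm_num)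

theorem integrable_sqrt_norm {γ : ℂ} (hγ : 0 < γ.im) (α : ℂ) :
    Integrable (fun x : ℝ => Real.sqrt ‖(x : ℂ) + α‖) (cauchyLaw γ) := by
  refine ((integrable_rpow_one_add_abs hγ (s := 1 / 2) (by norm_num)).const_mul
    (Real.sqrt (‖α‖ + 1))).mono' (by fun_prop) (ae_of_all _ fun x => ?_)
  rw [Real.norm_of_nonneg (Real.sqrt_nonneg _), ← Real.sqrt_eq_rpow,
    ← Real.sqrt_mul (by positivity)]
  exact Real.sqrt_le_sqrt (norm_ofReal_add_le le_rfl x)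

/-- The square cancels the decay of the density, leaving a translate of a Lebesgue-integrable
function; translation invariance makes the bound independent of `x`. -/
theorem exists_bound_integral_sq_div {α γ : ℂ} (hα : 0 < α.im) (hγ : 0 < γ.im) :
    ∃ D, ∀ x : ℝ,
      Integrable (fun y : ℝ => ‖(y : ℂ) + α‖ ^ 2 * (Real.sqrt ‖(x : ℂ) + y + 2 * α‖ ^ 3)⁻¹)
        (cauchyLaw γ) ∧
      ∫ y : ℝ, ‖(y : ℂ) + α‖ ^ 2 * (Real.sqrt ‖(x : ℂ) + y + 2 * α‖ ^ 3)⁻¹ ∂(cauchyLaw γ) ≤ D := by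
  obtain ⟨C, hC0, hC⟩ := exists_cauchyDensity_le hγ
  set J : ℝ → ℝ := fun y => (Real.sqrt ‖(y : ℂ) + 2 * α‖ ^ 3)⁻¹ with hJ
  have hJi : Integrable J := integrable_inv_sqrt_norm_pow_three (by simpa using hα)
  set E := C * (‖α‖ + 1) ^ 2 with hE
  have hshift : ∀ x y : ℝ, (Real.sqrt ‖(x : ℂ) + y + 2 * α‖ ^ 3)⁻¹ = J (x + y) := fun x y => by
    simp [hJ]
  have hle : ∀ x y : ℝ, cauchyDensity γ y • (‖(y : ℂ) + α‖ ^ 2 * J (x + y)) ≤ E * J (x + y) := by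
    intro x y
    have hJ0 : 0 ≤ J (x + y) := by simp only [hJ]; positivity
    rw [smul_eq_mul, ← mul_assoc]
    refine mul_le_mul_of_nonneg_right ?_ hJ0
    have h1 : ‖(y : ℂ) + α‖ ^ 2 ≤ ((‖α‖ + 1) * (1 + |y|)) ^ 2 := by
      gcongr; exact norm_ofReal_add_le le_rfl y
    refine (mul_le_mul (hC y) h1 (by positivity) (by positivity)).trans (le_of_eq ?_)
    rw [hE]; field_simp
  have hint : ∀ x : ℝ, Integrable fun y : ℝ =>
      cauchyDensity γ y • (‖(y : ℂ) + α‖ ^ 2 * J (x + y)) := by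
    intro x
    refine ((hJi.comp_add_left x).const_mul E).mono' ?_ (ae_of_all _ fun y => ?_)
    · have hm : Measurable J := by simp only [hJ]; fun_prop
      have := (continuous_cauchyDensity hγ).measurable
      exact (Measurable.smul this (by fun_prop)).aestronglyMeasurable
    · refine (le_of_eq (Real.norm_of_nonneg ?_)).trans (hle x y)
      have := cauchyDensity_nonneg hγ y
      simp only [hJ, smul_eq_mul]; positivity
  refine ⟨E * ∫ y, J y, fun x => ?_⟩
  simp_rw [hshift]
  rw [integrable_cauchyLaw_iff hγ, integral_cauchyLaw hγ]
  refine ⟨hint x, ?_⟩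
  refine (integral_mono (hint x) ((hJi.comp_add_left x).const_mul E) (hle x)).trans (le_of_eq ?_)
  rw [integral_const_mul, integral_add_left_eq_self]

theorem integrable_prod_sqrt_mul_sq_div {α γ : ℂ} (hα : 0 < α.im) (hγ : 0 < γ.im) :
    Integrable (fun z : ℝ × ℝ => Real.sqrt ‖(z.1 : ℂ) + α‖ *
      (‖(z.2 : ℂ) + α‖ ^ 2 * (Real.sqrt ‖(z.1 : ℂ) + z.2 + 2 * α‖ ^ 3)⁻¹))
      ((cauchyLaw γ).prod (cauchyLaw γ)) := by
  obtain ⟨D, hD⟩ := exists_bound_integral_sq_div hα hγ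
  have hm : AEStronglyMeasurable (fun z : ℝ × ℝ => Real.sqrt ‖(z.1 : ℂ) + α‖ *
      (‖(z.2 : ℂ) + α‖ ^ 2 * (Real.sqrt ‖(z.1 : ℂ) + z.2 + 2 * α‖ ^ 3)⁻¹))
      ((cauchyLaw γ).prod (cauchyLaw γ)) :=
    Measurable.aestronglyMeasurable (by fun_prop)
  rw [integrable_prod_iff hm]
  refine ⟨ae_of_all _ fun x => (hD x).1.const_mul (Real.sqrt ‖(x : ℂ) + α‖), ?_⟩
  refine ((integrable_sqrt_norm hγ α).mul_const D).mono' hm.norm.integral_prod_right'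
    (ae_of_all _ fun x => ?_)
  rw [Real.norm_of_nonneg (integral_nonneg fun y => norm_nonneg _)]
  have : ∀ y : ℝ, ‖Real.sqrt ‖(x : ℂ) + α‖ *
      (‖(y : ℂ) + α‖ ^ 2 * (Real.sqrt ‖(x : ℂ) + y + 2 * α‖ ^ 3)⁻¹)‖ = Real.sqrt ‖(x : ℂ) + α‖ *
      (‖(y : ℂ) + α‖ ^ 2 * (Real.sqrt ‖(x : ℂ) + y + 2 * α‖ ^ 3)⁻¹) := fun y =>
    Real.norm_of_nonneg (by positivity)
  simp_rw [this, integral_const_mul]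
  exact mul_le_mul_of_nonneg_left (hD x).2 (Real.sqrt_nonneg _)

/-- For the square roots A, B, C, multiply ABC ≤ A³ + B³ + C³ by AB/C³. With a = |x + α|, b = |y +
α| and c = |x + y + 2α|, each resulting term is integrable. -/
theorem mul_div_le_of_sqrt {a b c : ℝ} (ha : 0 < a) (hb : 0 < b) (hc : 0 < c) :
    a * b / c ≤ Real.sqrt a * Real.sqrt b +
      Real.sqrt a * (b ^ 2 * (Real.sqrt c ^ 3)⁻¹) + Real.sqrt b * (a ^ 2 * (Real.sqrt c ^ 3)⁻¹) := by
  obtain ⟨A, hA, rfl⟩ : ∃ A, 0 < A ∧ a = A ^ 2 :=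
    ⟨Real.sqrt a, Real.sqrt_pos.2 ha, (Real.sq_sqrt ha.le).symm⟩
  obtain ⟨B, hB, rfl⟩ : ∃ B, 0 < B ∧ b = B ^ 2 :=
    ⟨Real.sqrt b, Real.sqrt_pos.2 hb, (Real.sq_sqrt hb.le).symm⟩
  obtain ⟨C, hC, rfl⟩ : ∃ C, 0 < C ∧ c = C ^ 2 :=
    ⟨Real.sqrt c, Real.sqrt_pos.2 hc, (Real.sq_sqrt hc.le).symm⟩
  rw [Real.sqrt_sq hA.le, Real.sqrt_sq hB.le, Real.sqrt_sq hC.le]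
  have key : A * B * C ≤ A ^ 3 + B ^ 3 + C ^ 3 := by
    nlinarith [mul_nonneg (add_pos (add_pos hA hB) hC).le
      (add_nonneg (add_nonneg (sq_nonneg (A - B)) (sq_nonneg (B - C))) (sq_nonneg (C - A))),
      mul_pos (mul_pos hA hB) hC]
  have e : A * B + A * ((B ^ 2) ^ 2 * (C ^ 3)⁻¹) + B * ((A ^ 2) ^ 2 * (C ^ 3)⁻¹) =
      A * B * (A ^ 3 + B ^ 3 + C ^ 3) / C ^ 3 := by
    field_simp; ring
  rw [e, div_le_div_iff₀ (by positivity) (by positivity)]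
  have := mul_le_mul_of_nonneg_left key (by positivity : 0 ≤ A * B * C ^ 2)
  nlinarith

theorem integrable_powerMeanFormula_neg_one_two {α γ : ℂ} (hα : 0 < α.im) (hγ : 0 < γ.im) :
    Integrable (fun x : Fin 2 → ℝ => powerMeanFormula (-1) α fun i => (x i : ℂ))
      (Measure.pi fun _ => cauchyLaw γ) := by
  set μ := cauchyLaw γ
  have h1 := (integrable_sqrt_norm hγ α).mul_prod (integrable_sqrt_norm hγ α)
  have h2 := integrable_prod_sqrt_mul_sq_div hα hγ
  have h3 : Integrable (fun z : ℝ × ℝ => Real.sqrt ‖(z.2 : ℂ) + α‖ *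
      (‖(z.1 : ℂ) + α‖ ^ 2 * (Real.sqrt ‖(z.1 : ℂ) + z.2 + 2 * α‖ ^ 3)⁻¹)) (μ.prod μ) := by
    refine h2.swap.congr (ae_of_all _ fun z => ?_)
    simp only [Function.comp_apply, Prod.fst_swap, Prod.snd_swap]
    rw [add_comm (z.2 : ℂ) z.1]
  have h4 := (((h1.add h2).add h3).const_mul 2).add (integrable_const ‖α‖)
  have h5 := ((measurePreserving_finTwoArrow μ).integrable_comp_emb
    (MeasurableEquiv.measurableEmbedding _)).2 h4
  refine h5.mono' (measurable_powerMeanFormula (-1) α 2).aestronglyMeasurable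
    (ae_of_all _ fun x => ?_)
  have him : ∀ t : ℝ, (t : ℂ) + α ≠ 0 := fun t h => by
    have := congrArg Complex.im h
    simp at this; linarith
  have hsum : (x 0 : ℂ) + x 1 + 2 * α ≠ 0 := fun h => by
    have := congrArg Complex.im h
    simp at this; linarith
  have hform : powerMeanFormula (-1) α (fun i => (x i : ℂ)) =
      2 * (((x 0 : ℂ) + α) * ((x 1 : ℂ) + α) / ((x 0 : ℂ) + x 1 + 2 * α)) - α := by
    have e : ((1 / (-1) : ℝ) : ℂ) = -1 := by norm_num
    have h0 := him (x 0)
    have h1 := him (x 1)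
    rw [powerMeanFormula, e, Complex.cpow_neg_one, Fin.sum_univ_two, Complex.ofReal_neg,
      Complex.ofReal_one, Complex.cpow_neg_one, Complex.cpow_neg_one]
    have e2 : ((x 0 : ℂ) + α)⁻¹ + ((x 1 : ℂ) + α)⁻¹ =
        ((x 0 : ℂ) + x 1 + 2 * α) / (((x 0 : ℂ) + α) * ((x 1 : ℂ) + α)) := by
      field_simp; ring
    rw [e2, Nat.cast_ofNat, inv_div, div_div_eq_mul_div, mul_div_assoc]
  rw [hform]
  refine (norm_sub_le _ _).trans (add_le_add_left ?_ _)
  rw [norm_mul, Complex.norm_ofNat, norm_div, norm_mul]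
  refine mul_le_mul_of_nonneg_left ?_ (by norm_num)
  exact mul_div_le_of_sqrt (norm_pos_iff.2 (him _)) (norm_pos_iff.2 (him _)) (norm_pos_iff.2 hsum)

theorem integrable_powerMeanFormula {p : ℝ} (hp : -1 ≤ p) (hp0 : p < 0) {α γ : ℂ}
    (hα : 0 < α.im) (hγ : 0 < γ.im) {n : ℕ} (hn : 2 ≤ n) :
    Integrable (fun x : Fin n → ℝ => powerMeanFormula p α fun i => (x i : ℂ))
      (Measure.pi fun _ => cauchyLaw γ) := by
  rcases hp.eq_or_lt with rfl | hp1
  · rcases hn.eq_or_lt with rfl | hn1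
    · exact integrable_powerMeanFormula_neg_one_two hα hγ
    · exact integrable_powerMeanFormula_neg_one_of_three_le hα hγ hn1
  · exact integrable_powerMeanFormula_of_neg_one_lt hp1 hp0 hα hγ hn

/-! ### Shift on the boundary: limit from above -/

theorem ae_forall_ofReal_add_ne_zero {γ : ℂ} (hγ : 0 < γ.im) (α : ℂ) (n : ℕ) :
    ∀ᵐ x : Fin n → ℝ ∂(Measure.pi fun _ => cauchyLaw γ), ∀ j, (x j : ℂ) + α ≠ 0 := by
  have h : ∀ᵐ t : ℝ ∂(cauchyLaw γ), (t : ℂ) + α ≠ 0 := by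
    refine measure_mono_null (t := {-α.re}) (fun t ht => ?_) (cauchyLaw_singleton hγ _)
    have h0 : (t : ℂ) + α = 0 := not_not.1 ht
    have := congrArg Complex.re h0
    simp at this
    simp; linarith
  exact ae_all_iff.2 fun j => (measurePreserving_eval (fun _ : Fin n => cauchyLaw γ) j).quasiMeasurePreserving.ae h

theorem average_ne_zero {p : ℝ} (hp : -1 < p) (hp0 : p < 0) {n : ℕ} (hn : n ≠ 0) {u : Fin n → ℂ}
    (hu : ∀ j, 0 ≤ (u j).im) (h0 : ∀ j, u j ≠ 0) : (∑ j, u j ^ (p : ℂ)) / (n : ℂ) ≠ 0 := by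
  have hn' : (0 : ℝ) < n := Nat.cast_pos.2 (Nat.pos_of_ne_zero hn)
  refine norm_pos_iff.1 (lt_of_lt_of_le ?_ (le_norm_average hp.le hp0 hu h0))
  refine mul_pos (cos_mul_pi_div_two_pos hp hp0) (div_pos (Finset.sum_pos (fun j _ =>
    Real.rpow_pos_of_pos (norm_pos_iff.2 (h0 j)) _) ⟨⟨0, Nat.pos_of_ne_zero hn⟩, Finset.mem_univ _⟩) hn')

theorem powerMean_eq_formula_of_neg_one_lt {p : ℝ} (hp : -1 < p) (hp0 : p < 0) {α : ℂ}
    (hα : 0 ≤ α.im) {n : ℕ} (hn : n ≠ 0) (x : Fin n → ℝ) (h0 : ∀ j, (x j : ℂ) + α ≠ 0) :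
    powerMean p α x = powerMeanFormula p α fun j => x j := by
  have hu : ∀ j, 0 ≤ ((x j : ℂ) + α).im := fun j => by simpa using hα
  have hw := average_ne_zero hp hp0 hn hu h0
  have h := average_arg_mem hp hp0 hu hw
  exact powerMean_eq_formula hp.le hp0 α x hw h.1 h.2

/-- On the negative axis the principal logarithm is continuous from above, the side from which the
shifts approach. -/
theorem continuousWithinAt_cpow_upper (p : ℂ) {u : ℂ} (h0 : u ≠ 0) :
    ContinuousWithinAt (fun z : ℂ => z ^ p) {z | 0 ≤ z.im} u := by
  by_cases hs : u ∈ Complex.slitPlane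
  · exact (continuousAt_cpow_const hs).continuousWithinAt
  · rw [Complex.mem_slitPlane_iff, not_or, not_lt, not_not] at hs
    have hre : u.re < 0 := lt_of_le_of_ne hs.1 fun h => h0 (Complex.ext h hs.2)
    have hlog := Complex.continuousWithinAt_log_of_re_neg_of_im_zero hre hs.2
    have h1 : ContinuousWithinAt (fun z : ℂ => Complex.exp (Complex.log z * p)) {z | 0 ≤ z.im} u :=
      (hlog.mul continuousWithinAt_const).cexp
    refine h1.congr_of_eventuallyEq ?_ (Complex.cpow_def_of_ne_zero h0 p)
    filter_upwards [nhdsWithin_le_nhds (isOpen_ne.mem_nhds h0)] with z hz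
    exact Complex.cpow_def_of_ne_zero hz p

/-- The inner powers may sit on the branch cut, so one-sided continuity is used there; the average
has argument at most 0 and avoids the cut. -/
theorem tendsto_powerMeanFormula {p : ℝ} (hp : -1 < p) (hp0 : p < 0) {α : ℂ} (hα : 0 ≤ α.im)
    {n : ℕ} (hn : n ≠ 0) (x : Fin n → ℝ) (h0 : ∀ j, (x j : ℂ) + α ≠ 0) {ι : Type*} {l : Filter ι}
    {a : ι → ℂ} (ha : Tendsto a l (𝓝 α)) (him : ∀ i, 0 ≤ (a i).im) :
    Tendsto (fun i => powerMeanFormula p (a i) fun j => (x j : ℂ)) l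
      (𝓝 (powerMeanFormula p α fun j => (x j : ℂ))) := by
  have hu : ∀ j, 0 ≤ ((x j : ℂ) + α).im := fun j => by simpa using hα
  have hw := average_ne_zero hp hp0 hn hu h0
  have harg := average_arg_mem hp hp0 hu hw
  have hslit : (∑ j, ((x j : ℂ) + α) ^ (p : ℂ)) / (n : ℂ) ∈ Complex.slitPlane :=
    Complex.mem_slitPlane_iff_arg.2 ⟨by have := Real.pi_pos; linarith [harg.2], hw⟩
  have h1 : ∀ j, Tendsto (fun i => ((x j : ℂ) + a i) ^ (p : ℂ)) l
      (𝓝 (((x j : ℂ) + α) ^ (p : ℂ))) := fun j =>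
    (continuousWithinAt_cpow_upper (p : ℂ) (h0 j)).tendsto.comp
      (tendsto_nhdsWithin_iff.2 ⟨ha.const_add _, Eventually.of_forall fun i => by simpa using him i⟩)
  exact ((continuousAt_cpow_const hslit).tendsto.comp
    ((tendsto_finsetSum _ fun j _ => h1 j).div_const _)).sub ha

/-- For real α the generator is singular at the boundary point -α, so the mean value is obtained as
a limit over shifts α + i/(k + 1). -/
theorem integral_powerMean_of_neg_one_lt {p : ℝ} (hp : -1 < p) (hp0 : p < 0) {α γ : ℂ}
    (hα : 0 ≤ α.im) (hγ : 0 < γ.im) {n : ℕ} (hn : 2 ≤ n) :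
    Integrable (fun x : Fin n → ℝ => powerMean p α x) (Measure.pi fun _ => cauchyLaw γ) ∧
      ∫ x : Fin n → ℝ, powerMean p α x ∂(Measure.pi fun _ => cauchyLaw γ) = γ := by
  have hn' : (2 : ℝ) ≤ n := by exact_mod_cast hn
  have hn0 : n ≠ 0 := by omega
  have hae := ae_forall_ofReal_add_ne_zero hγ α n
  have heq : (fun x : Fin n → ℝ => powerMean p α x)
      =ᵐ[Measure.pi fun _ => cauchyLaw γ] fun x => powerMeanFormula p α fun j => (x j : ℂ) := by
    filter_upwards [hae] with x hx
    exact powerMean_eq_formula_of_neg_one_lt hp hp0 hα hn0 x hx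
  -- The radius `‖α‖ + 1` accommodates every shift `a k`.
  set bound : (Fin n → ℝ) → ℝ := fun x => Real.cos (p * (Real.pi / 2)) ^ (1 / p) *
      ∏ j, ((‖α‖ + 1 + 1) * (1 + |x j|)) ^ (1 / n : ℝ) + (‖α‖ + 1) with hbound
  have hbi : Integrable bound (Measure.pi fun _ => cauchyLaw γ) := by
    refine ((integrable_prod_rpow hγ (s := 1 / n) ?_ n (by positivity)).const_mul _).add
      (integrable_const _)
    rw [div_lt_one (by linarith)]; linarith
  set a : ℕ → ℂ := fun k => α + ((1 / ((k : ℝ) + 1) : ℝ) : ℂ) * Complex.I with ha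
  have haim : ∀ k, 0 < (a k).im := fun k => by
    have : (0 : ℝ) < 1 / ((k : ℝ) + 1) := by positivity
    simp only [ha, Complex.add_im, Complex.im_ofReal_mul, Complex.I_im, mul_one]
    linarith
  have hanorm : ∀ k, ‖a k‖ ≤ ‖α‖ + 1 := fun k => by
    refine (norm_add_le _ _).trans (add_le_add_right ?_ _)
    rw [norm_mul, Complex.norm_I, mul_one, Complex.norm_real, Real.norm_of_nonneg (by positivity),
      div_le_one (by positivity)]
    linarith [(Nat.cast_nonneg k : (0 : ℝ) ≤ k)]
  have halim : Tendsto a atTop (𝓝 α) := by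
    have h1 : Tendsto (fun k : ℕ => ((1 / ((k : ℝ) + 1) : ℝ) : ℂ)) atTop (𝓝 ((0 : ℝ) : ℂ)) :=
      (Complex.continuous_ofReal.tendsto _).comp tendsto_one_div_add_atTop_nhds_zero_nat
    simpa [ha] using (h1.mul_const Complex.I).const_add α
  have hle : ∀ k, ∀ x : Fin n → ℝ, ‖powerMeanFormula p (a k) fun j => (x j : ℂ)‖ ≤ bound x :=
    fun k x => norm_powerMeanFormula_le_of_neg_one_lt hp hp0 (haim k).le (hanorm k) hn0 x
      fun j h => by
        have := congrArg Complex.im h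
        rw [Complex.add_im, Complex.ofReal_im, zero_add, Complex.zero_im] at this
        linarith [haim k]
  have hlim := tendsto_integral_of_dominated_convergence bound
    (fun k => (measurable_powerMeanFormula p (a k) n).aestronglyMeasurable) hbi
    (fun k => ae_of_all _ (hle k))
    (hae.mono fun x hx => tendsto_powerMeanFormula hp hp0 hα hn0 x hx halim fun k => (haim k).le)
  simp_rw [fun k => integral_powerMeanFormula hp.le hp0 (haim k) hγ hn
    (integrable_powerMeanFormula hp.le hp0 (haim k) hγ hn)] at hlim
  refine ⟨Integrable.congr ?_ heq.symm, ?_⟩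
  · refine hbi.mono' (measurable_powerMeanFormula p α n).aestronglyMeasurable
      (hae.mono fun x hx => ?_)
    exact norm_powerMeanFormula_le_of_neg_one_lt hp hp0 hα (by linarith) hn0 x hx
  · rw [integral_congr_ae heq]
    exact tendsto_nhds_unique hlim tendsto_const_nhds

/-! ### Exponent -1 with real shift: non-integrability -/

theorem powerGen_neg_one (α z : ℂ) : powerGen (-1) α z = (z + α)⁻¹ := by
  rw [powerGen, Complex.ofReal_neg, Complex.ofReal_one, Complex.cpow_neg_one]

theorem invFunOn_powerGen_neg_one (α s : ℝ) (hs : s ≠ 0) :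
    Function.invFunOn (powerGen (-1) (α : ℂ)) (powerDomain α) (s : ℂ) = (s : ℂ)⁻¹ - α := by
  have hs' : (s : ℂ)⁻¹ ≠ 0 := inv_ne_zero (Complex.ofReal_ne_zero.2 hs)
  have hm : (s : ℂ)⁻¹ - α ∈ powerDomain (α : ℂ) := by
    refine ⟨?_, fun h => hs' (by linear_combination h)⟩
    rw [sub_add_cancel, ← Complex.ofReal_inv, Complex.ofReal_im]
  have hi := (powerGen_injOn (p := -1) le_rfl (by norm_num) (α : ℂ)).leftInvOn_invFunOn hm
  rwa [powerGen_neg_one, sub_add_cancel, inv_inv] at hi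

open Classical in
/-- The power mean with exponent `-1` and real shift, with its value where the harmonic mean is
undefined written as a constant. -/
theorem powerMean_neg_one_ofReal (α : ℝ) {n : ℕ} (x : Fin n → ℝ) :
    powerMean (-1) (α : ℂ) x = if (∑ j, (x j + α)⁻¹) / n = 0 then
      Function.invFunOn (powerGen (-1) (α : ℂ)) (powerDomain α) 0
      else (((∑ j, (x j + α)⁻¹) / n : ℝ) : ℂ)⁻¹ - α := by
  have h : (∑ j, powerGen (-1) (α : ℂ) (x j : ℂ)) / (n : ℂ) =
      (((∑ j, (x j + α)⁻¹) / n : ℝ) : ℂ) := by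
    simp only [powerGen_neg_one]; push_cast; rfl
  rw [powerMean, quasiArithmeticMean, h]
  split_ifs with h0
  · rw [h0, Complex.ofReal_zero]
  · exact invFunOn_powerGen_neg_one α _ h0

theorem measurable_powerMean_neg_one_ofReal (α : ℝ) (n : ℕ) :
    Measurable fun x : Fin n → ℝ => powerMean (-1) (α : ℂ) x := by
  classical
  simp_rw [powerMean_neg_one_ofReal]
  refine Measurable.ite ?_ measurable_const (by fun_prop)
  exact (by fun_prop : Measurable fun x : Fin n → ℝ => (∑ j, (x j + α)⁻¹) / (n : ℝ))
    (measurableSet_singleton 0)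

/-- Quadratic decay of the density is sharp, so linear growth leaves a multiple of 1/t on a ray. -/
theorem not_integrable_cauchyLaw_of_linear_growth {γ : ℂ} (hγ : 0 < γ.im) {g : ℝ → ℂ} {T k : ℝ}
    (hk : 0 < k) (hg : ∀ t, T ≤ t → k * t ≤ ‖g t‖) : ¬ Integrable g (cauchyLaw γ) := by
  intro hint
  obtain ⟨c, hc, hcd⟩ := exists_le_cauchyDensity hγ
  rw [integrable_cauchyLaw_iff hγ] at hint
  have hS : IntegrableOn (fun t : ℝ => t⁻¹) (Ici (max T 1)) := by
    refine ((hint.norm.const_mul (4 / (c * k))).integrableOn).mono'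
      measurable_inv.aestronglyMeasurable ?_
    filter_upwards [ae_restrict_mem measurableSet_Ici] with t ht
    have ht1 : 1 ≤ t := (le_max_right _ _).trans ht
    have htT : T ≤ t := (le_max_left _ _).trans ht
    have ht0 : 0 < t := by linarith
    rw [norm_smul, Real.norm_of_nonneg (cauchyDensity_nonneg hγ t), Real.norm_of_nonneg (by positivity)]
    have h1 : c / (4 * t ^ 2) ≤ cauchyDensity γ t := by
      refine le_trans ?_ (hcd t)
      rw [abs_of_pos ht0, ← div_eq_mul_inv]
      refine div_le_div_of_nonneg_left hc.le (by positivity) ?_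
      nlinarith
    have h2 : c / (4 * t ^ 2) * (k * t) ≤ cauchyDensity γ t * ‖g t‖ :=
      mul_le_mul h1 (hg t htT) (by positivity) (cauchyDensity_nonneg hγ t)
    refine le_trans (le_of_eq ?_) (mul_le_mul_of_nonneg_left h2 (by positivity))
    field_simp
  exact not_integrableOn_Ici_inv hS

/-- The density is continuous and positive at `c`, so it cannot soften the pole. -/
theorem not_integrable_cauchyLaw_of_simple_pole {γ : ℂ} (hγ : 0 < γ.im) {g : ℝ → ℂ} {c : ℝ}
    (hg : (fun t => (t - c)⁻¹) =O[𝓝[≠] c] g) : ¬ Integrable g (cauchyLaw γ) := by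
  intro hint
  rw [integrable_cauchyLaw_iff hγ] at hint
  refine not_intervalIntegrable_of_sub_inv_isBigO_punctured
    (f := fun t => cauchyDensity γ t • g t) (a := c) (b := c + 1) (c := c) ?_ (by simp) (by simp)
    hint.intervalIntegrable
  refine hg.trans ?_
  have hpos : ∀ t, 0 < cauchyDensity γ t := fun t => by unfold cauchyDensity; positivity
  have h1 : (fun t => (cauchyDensity γ t)⁻¹) =O[𝓝[≠] c] (fun _ => (1 : ℝ)) :=
    (((continuous_cauchyDensity hγ).inv₀ fun t => (hpos t).ne').continuousAt.tendsto.mono_left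
      nhdsWithin_le_nhds).isBigO_one ℝ
  have h2 := h1.smul (Asymptotics.isBigO_refl (fun t => cauchyDensity γ t • g t) (𝓝[≠] c))
  simp only [one_smul] at h2
  refine h2.congr_left fun t => ?_
  rw [smul_smul, inv_mul_cancel₀ (hpos t).ne', one_smul]

open Classical in
-- Here `s` is the sum of the other reciprocals. If s ≠ 0 the denominator vanishes at t = -α - 1/s;
-- if s = 0 the section is affine in t away from -α. No value of `s` is exceptional.
theorem not_integrable_harmonic_section {γ : ℂ} (hγ : 0 < γ.im) (α s : ℝ) (C : ℂ) {n : ℕ}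
    (hn : n ≠ 0) :
    ¬ Integrable (fun t : ℝ => if ((t + α)⁻¹ + s) / n = 0 then C
      else ((((t + α)⁻¹ + s) / n : ℝ) : ℂ)⁻¹ - α) (cauchyLaw γ) := by
  have hn' : (0 : ℝ) < n := Nat.cast_pos.2 (Nat.pos_of_ne_zero hn)
  have hn1 : (1 : ℝ) ≤ n := by exact_mod_cast Nat.pos_of_ne_zero hn
  intro hint
  have hint2 := hint.add (integrable_const (α : ℂ))
  rcases eq_or_ne s 0 with rfl | hs
  · refine not_integrable_cauchyLaw_of_linear_growth hγ (T := 2 * |α| + 1) (k := 1 / 2)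
      (by norm_num) (fun t ht => ?_) hint2
    have hα := neg_abs_le α
    have hα0 := abs_nonneg α
    have h0 : 0 < t + α := by linarith
    have hne : ((t + α)⁻¹ + 0) / (n : ℝ) ≠ 0 := by positivity
    simp only [Pi.add_apply, if_neg hne, sub_add_cancel]
    rw [← Complex.ofReal_inv, Complex.norm_real, add_zero, inv_div, div_inv_eq_mul,
      Real.norm_of_nonneg (by positivity)]
    nlinarith
  · have hs' : s⁻¹ ≠ 0 := inv_ne_zero hs
    refine not_integrable_cauchyLaw_of_simple_pole hγ (c := -α - s⁻¹) ?_ hint2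
    -- This function is the ratio of 1/(t - c) to the section with α added back, for c = -α - 1/s;
    -- its finite limit gives the required big-O.
    have hcont : Tendsto (fun t : ℝ => s / (n * (t + α))) (𝓝[≠] (-α - s⁻¹))
        (𝓝 (s / (n * (-α - s⁻¹ + α)))) := by
      refine Tendsto.mono_left (ContinuousAt.tendsto ?_) nhdsWithin_le_nhds
      refine continuousAt_const.div (by fun_prop) ?_
      refine mul_ne_zero hn'.ne' ?_
      rw [show -α - s⁻¹ + α = -s⁻¹ by ring]
      exact neg_ne_zero.2 hs'
    have hev : ∀ᶠ t in 𝓝[≠] (-α - s⁻¹), t ≠ -α :=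
      nhdsWithin_le_nhds (isOpen_ne.mem_nhds (by simpa using hs))
    have hO := (hcont.isBigO_one ℝ).mul (Asymptotics.isBigO_refl
      (fun t : ℝ => (((t + α)⁻¹ + s) / n)⁻¹) (𝓝[≠] (-α - s⁻¹)))
    simp only [one_mul] at hO
    refine (hO.congr' ?_ EventuallyEq.rfl).trans (Asymptotics.IsBigO.of_bound 1 ?_)
    · filter_upwards [hev, self_mem_nhdsWithin] with t ht htc
      have h1 : t + α ≠ 0 := fun h => ht (by linarith)
      have h3 : t - (-α - s⁻¹) ≠ 0 := sub_ne_zero.2 htc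
      have h4 : (t + α)⁻¹ + s = s * (t - (-α - s⁻¹)) / (t + α) := by
        field_simp; ring
      rw [h4]
      generalize t - (-α - s⁻¹) = d at *
      field_simp
    · filter_upwards [hev, self_mem_nhdsWithin] with t ht htc
      have h1 : t + α ≠ 0 := fun h => ht (by linarith)
      have h3 : t - (-α - s⁻¹) ≠ 0 := sub_ne_zero.2 htc
      have h4 : (t + α)⁻¹ + s = s * (t - (-α - s⁻¹)) / (t + α) := by
        field_simp; ring
      have hne : ((t + α)⁻¹ + s) / n ≠ 0 := by
        rw [h4]; exact div_ne_zero (div_ne_zero (mul_ne_zero hs h3) h1) hn'.ne'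
      simp only [Pi.add_apply, if_neg hne, sub_add_cancel]
      rw [← Complex.ofReal_inv, Complex.norm_real, one_mul]

/-- Fubini would make almost every section in the first coordinate integrable, but none is. -/
theorem not_integrable_powerMean_neg_one_ofReal {γ : ℂ} (hγ : 0 < γ.im) (α : ℝ) {n : ℕ}
    (hn : n ≠ 0) :
    ¬ Integrable (fun x : Fin n → ℝ => powerMean (-1) (α : ℂ) x)
      (Measure.pi fun _ => cauchyLaw γ) := by
  classical
  obtain ⟨m, rfl⟩ := Nat.exists_eq_succ_of_ne_zero hn
  intro hint
  have hmp := (measurePreserving_piFinSuccAbove (fun _ : Fin (m + 1) => cauchyLaw γ) 0).symm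
  have hint' : Integrable (fun y : ℝ × (Fin m → ℝ) =>
      powerMean (-1) (α : ℂ) (Fin.insertNth (α := fun _ => ℝ) 0 y.1 y.2))
      ((cauchyLaw γ).prod (Measure.pi fun _ => cauchyLaw γ)) :=
    (hmp.integrable_comp_emb (MeasurableEquiv.measurableEmbedding _)).2 hint
  obtain ⟨x, hx⟩ := hint'.prod_left_ae.exists
  simp only [powerMean_neg_one_ofReal, Fin.sum_univ_succ, Fin.insertNth_zero', Fin.cons_zero,
    Fin.cons_succ] at hx
  exact not_integrable_harmonic_section hγ α _ _ hn hx

/-! ### Transfer to the random variables -/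

theorem integral_powerMean_of_im_pos {p : ℝ} (hp : -1 ≤ p) (hp0 : p < 0) {α γ : ℂ}
    (hα : 0 < α.im) (hγ : 0 < γ.im) {n : ℕ} (hn : 2 ≤ n) :
    Integrable (fun x : Fin n → ℝ => powerMean p α x) (Measure.pi fun _ => cauchyLaw γ) ∧
      ∫ x : Fin n → ℝ, powerMean p α x ∂(Measure.pi fun _ => cauchyLaw γ) = γ := by
  simp_rw [powerMean_eq_formula_of_im_pos hp hp0 hα (by omega : n ≠ 0)]
  have hint := integrable_powerMeanFormula hp hp0 hα hγ hn
  exact ⟨hint, integral_powerMeanFormula hp hp0 hα hγ hn hint⟩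

/-- In the second clause, measurability is asserted separately so that failure of `Integrable` means
E|M| = ∞. -/
theorem mainTheorem9 {Ω : Type*} [MeasurableSpace Ω] (P : Measure Ω) [IsProbabilityMeasure P]
    (γ : ℂ) (hγ : 0 < γ.im) (n : ℕ) (hn : 2 ≤ n) (X : Fin n → Ω → ℝ)
    (hindep : iIndepFun X P) (hlaw : ∀ j, HasLaw (X j) (cauchyLaw γ) P) :
    (∀ (p : ℝ) (α : ℂ), -1 < p → p < 0 → 0 ≤ α.im →
      Integrable (fun ω => powerMean p α (fun j => X j ω)) P ∧
        ∫ ω, powerMean p α (fun j => X j ω) ∂P = γ) ∧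
    (∀ α : ℝ,
      AEStronglyMeasurable (fun ω => powerMean (-1) (α : ℂ) (fun j => X j ω)) P ∧
        ¬ Integrable (fun ω => powerMean (-1) (α : ℂ) (fun j => X j ω)) P) ∧
    (∀ α : ℂ, 0 < α.im →
      Integrable (fun ω => powerMean (-1) α (fun j => X j ω)) P ∧
        ∫ ω, powerMean (-1) α (fun j => X j ω) ∂P = γ) := by
  have hXm : ∀ j, AEMeasurable (X j) P := fun j => (hlaw j).aemeasurable
  have hX : AEMeasurable (fun ω j => X j ω) P := aemeasurable_pi_lambda _ hXm
  -- Independence turns the joint law into the product measure, to which everything above applies.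
  have hmap : P.map (fun ω j => X j ω) = Measure.pi fun _ => cauchyLaw γ := by
    rw [(iIndepFun_iff_map_fun_eq_pi_map hXm).1 hindep]
    simp_rw [fun j => (hlaw j).map_eq]
  have htransfer : ∀ G : (Fin n → ℝ) → ℂ,
      Integrable G (Measure.pi fun _ => cauchyLaw γ) ∧
        ∫ x, G x ∂(Measure.pi fun _ => cauchyLaw γ) = γ →
      Integrable (fun ω => G fun j => X j ω) P ∧ ∫ ω, G (fun j => X j ω) ∂P = γ := by
    intro G hG
    rw [← hmap] at hG
    refine ⟨hG.1.comp_aemeasurable hX, ?_⟩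
    rw [← integral_map hX hG.1.aestronglyMeasurable]
    exact hG.2
  refine ⟨fun p α hp hp0 hα => htransfer _ (integral_powerMean_of_neg_one_lt hp hp0 hα hγ hn),
    fun α => ⟨?_, fun h => ?_⟩, fun α hα =>
    htransfer _ (integral_powerMean_of_im_pos le_rfl (by norm_num) hα hγ hn)⟩
  · exact ((measurable_powerMean_neg_one_ofReal α n).comp_aemeasurable hX).aestronglyMeasurable
  · refine not_integrable_powerMean_neg_one_ofReal hγ α (by omega : n ≠ 0) ?_
    rw [← hmap]
    exact (integrable_map_measure
      (measurable_powerMean_neg_one_ofReal α n).aestronglyMeasurable hX).2 h
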